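/- The problem $\textsc{Match}$ with regular constraints: given an alphabet $\Sigma=\{0,\dots,\sigma-1\}$, a word $w\in\Sigma^*$, a word $p\in\Sigma^*$ and a tuple $gc=(C_1,\dots,C_{|p|-1})$ of regular languages over $\Sigma$, each represented by a DFA $A_i$, where $1\le|p|\le|w|$ and $\sigma\le|w|$, decide whether there is a strictly increasing map $e:\{1,\dots,|p|\}\to\{1,\dots,|w|\}$ such that $w[e(i)]=p[i]$ for all $i\le|p|$ and $w[e(i)+1]\cdots w[e(i+1)-1]\in C_i$ for all $i<|p|$. Let $\mathrm{states}(gc)$ be the total number of states of those $A_i$ for which $C_i\neq\{\varepsilon\}$, and let $N$ be the length of the input. Algorithms are programs of the unit-cost RAM with logarithmic word size (unit-cost arithmetic, bitwise and memory operations on numbers of $O(\log N)$ bits). The Orthogonal Vectors Hypothesis (OVH) states that for no $\varepsilon>0$ and no polynomial $q$ there is such a program that decides in time $O(n^{2-\varepsilon}q(d))$, for given $a_1,\dots,a_n,b_1,\dots,b_n\in\{0,1\}^d$ with $n,d\ge 1$, whether there are $i,j$ with $a_i[k]\cdot b_j[k]=0$ for all $k\in\{1,\dots,d\}$. Theorem.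 Assume OVH. (1) For all real $h,g$ and $\varepsilon>0$ with $h+g=2-\varepsilon$, $\textsc{Match}$ with regular constraints cannot be solved in time $O(|w|^h\cdot\mathrm{states}(gc)^g)$. (2) There is a constant $K$ such that, for all real $h,g$ and $\varepsilon>0$ with $h+g=2-\varepsilon$, this remains true for the restriction of the problem to the instances with $|\Sigma|=4$ in which every $A_i$ has at most $K$ states. Both parts hold even if additional time linear in $N$ is granted, i.e. they exclude the running time $O(|w|^h\cdot\mathrm{states}(gc)^g+N)$. -/

import Mathlib

noncomputable section

/-! ## The unit-cost RAM with logarithmic word size -/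

namespace RAM

/-- Arithmetic and bitwise operations, each executed in one step. Subtraction is truncated, and
division and remainder follow the conventions of `ℕ` for the divisor zero. -/
inductive BinOp
  | add | sub | mul | div | mod | and | or | xor | shiftLeft | shiftRight

def BinOp.eval : BinOp → ℕ → ℕ → ℕ
  | .add, x, y => x + y
  | .sub, x, y => x - y
  | .mul, x, y => x * y
  | .div, x, y => x / y
  | .mod, x, y => x % y
  | .and, x, y => x &&& y
  | .or, x, y => x ||| y
  | .xor, x, y => x ^^^ y
  | .shiftLeft, x, y => x <<< y
  | .shiftRight, x, y => x >>> y

/-- Instructions; `r`, `a`, `b` are register names, `l` is a line number of the program. -/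
inductive Instr
  /-- `R[r] := k` -/
  | const (r k : ℕ)
  /-- `R[r] := R[a] o R[b]` -/
  | op (o : BinOp) (r a b : ℕ)
  /-- `R[r] := M[R[a]]` -/
  | load (r a : ℕ)
  /-- `M[R[a]] := R[r]` -/
  | store (a r : ℕ)
  /-- continue at line `l` -/
  | jump (l : ℕ)
  /-- continue at line `l` if `R[a] = 0`, and at the next line otherwise -/
  | jumpIfZero (a l : ℕ)

abbrev Program := List Instr

/-- A configuration: the current line, the registers, and the random access memory. -/
structure Config where
  pc : ℕ
  regs : ℕ → ℕ
  mem : ℕ → ℕ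

/-- The effect of executing one instruction. -/
def Instr.exec : Instr → Config → Config
  | .const r k, c => ⟨c.pc + 1, Function.update c.regs r k, c.mem⟩
  | .op o r a b, c => ⟨c.pc + 1, Function.update c.regs r (o.eval (c.regs a) (c.regs b)), c.mem⟩
  | .load r a, c => ⟨c.pc + 1, Function.update c.regs r (c.mem (c.regs a)), c.mem⟩
  | .store a r, c => ⟨c.pc + 1, c.regs, Function.update c.mem (c.regs a) (c.regs r)⟩
  | .jump l, c => ⟨l, c.regs, c.mem⟩
  | .jumpIfZero a l, c => ⟨if c.regs a = 0 then l else c.pc + 1, c.regs, c.mem⟩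

/-- The machine has halted when the current line lies outside the program. -/
def Halted (P : Program) (c : Config) : Prop := P.length ≤ c.pc

/-- One step of the machine; a halted machine does not move any more. -/
def step (P : Program) (c : Config) : Config :=
  match P[c.pc]? with
  | none => c
  | some i => i.exec c

/-- The configuration after `t` steps. -/
def run (P : Program) (t : ℕ) (c : Config) : Config := (step P)^[t] c

/-- The input, a list of numbers, is stored in the memory cells `0, 1, …`, and its length in
register `0`; all other cells and registers hold zero. -/
def init (x : List ℕ) : Config where
  pc := 0
  regs := fun r => if r = 0 then x.length else 0
  mem := fun a => x.getD a 0

/-- Every register and every memory cell holds a number that is at most `B`. -/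
def Config.BoundedBy (c : Config) (B : ℕ) : Prop := (∀ r, c.regs r ≤ B) ∧ ∀ a, c.mem a ≤ B

/-- `P` decides the problem with question `yes` on the instances in `S`, given in the encoding
`enc`, in at most `T x` steps on the instance `x`. The answer is positive iff register `0` holds `1`
in the end. The word size is logarithmic: for some constant `c`, all numbers that occur in the
computation on an input of length `N` are at most `(N + 2) ^ c`, i.e. have `O(log N)` bits. -/
def Decides (P : Program) {ι : Type} (enc : ι → List ℕ) (yes : ι → Prop) (S : Set ι)
    (T : ι → ℝ) : Prop :=
  ∃ c : ℕ, ∀ x ∈ S, ∃ t : ℕ, (t : ℝ) ≤ T x ∧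
    Halted P (run P t (init (enc x))) ∧
    ((run P t (init (enc x))).regs 0 = 1 ↔ yes x) ∧
    ∀ s ≤ t, (run P s (init (enc x))).BoundedBy (((enc x).length + 2) ^ c)

end RAM

/-! ## Orthogonal vectors -/

/-- An instance of OV: two families of `n` Boolean vectors of dimension `d`. -/
structure OVInstance where
  n : ℕ
  d : ℕ
  n_pos : 0 < n
  d_pos : 0 < d
  A : Fin n → Fin d → Bool
  B : Fin n → Fin d → Bool

namespace OVInstance

/-- Some vector of the first family is orthogonal to some vector of the second one. -/
def HasOrthogonalPair (x : OVInstance) : Prop :=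
  ∃ i j, ∀ k, (x.A i k).toNat * (x.B j k).toNat = 0

/-- The numbers `n` and `d`, followed by the entries of the vectors, one per memory cell. -/
def encode (x : OVInstance) : List ℕ :=
  [x.n, x.d]
    ++ (List.ofFn fun i => List.ofFn fun k => (x.A i k).toNat).flatten
    ++ (List.ofFn fun i => List.ofFn fun k => (x.B i k).toNat).flatten

end OVInstance

/-- The orthogonal vectors hypothesis: for no `ε > 0` can OV be solved in time
`O(n ^ (2 - ε) * poly(d))`. -/
def OVH : Prop :=
  ∀ ε : ℝ, 0 < ε → ¬ ∃ (P : RAM.Program) (C : ℝ) (q : Polynomial ℕ),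
    RAM.Decides P OVInstance.encode OVInstance.HasOrthogonalPair Set.univ
      (fun x => C * (x.n : ℝ) ^ (2 - ε) * ((q.eval x.d : ℕ) : ℝ))

/-! ## Subsequences with gap constraints -/

/-- The factor of `w` strictly between the positions `a` and `b` (positions counted from `0`). -/
def gapWord {α : Type} (w : List α) (a b : ℕ) : List α := (w.take b).drop (a + 1)

/-- `p` is a `gc`-subsequence of `w`: some strictly increasing map from the positions of `p` to
those of `w` respects the letters, and its `j`-th gap belongs to the language `gc j`, for all `j`. -/
def IsGapSubseq {α : Type} (p : List α) (gc : Fin (p.length - 1) → Language α) (w : List α) :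
    Prop :=
  ∃ e : Fin p.length → Fin w.length, StrictMono e ∧
    (∀ i, w.get (e i) = p.get i) ∧
    ∀ j : Fin (p.length - 1),
      gapWord w (e ⟨j, by omega⟩) (e ⟨j + 1, by omega⟩) ∈ gc j

/-- A regular constraint over the alphabet `{0, …, σ - 1}`, represented by a DFA with the states
`0, …, numStates - 1`. -/
structure RegConstraint (σ : ℕ) where
  numStates : ℕ
  dfa : DFA (Fin σ) (Fin numStates)

namespace RegConstraint

variable {σ : ℕ}

def language (A : RegConstraint σ) : Language (Fin σ) := A.dfa.accepts

/-- The language of the constraint is `{ε}`. -/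
def IsZeroGap (A : RegConstraint σ) : Prop := ∀ v : List (Fin σ), v ∈ A.language ↔ v = []

open Classical in
/-- The number of states, the initial state, the indicator of the accepting states, and the
transition table. -/
def encode (A : RegConstraint σ) : List ℕ :=
  [A.numStates, (A.dfa.start : ℕ)]
    ++ (List.ofFn fun s => if s ∈ A.dfa.accept then 1 else 0)
    ++ (List.ofFn fun s => List.ofFn fun a => (A.dfa.step s a : ℕ)).flatten

end RegConstraint

/-- An instance of the matching problem with regular constraints: an alphabet `{0, …, σ - 1}`, a
word `w`, and a gapped sequence `(p, gc)`. As usual, neither the alphabet nor `p` is larger than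
the word `w`. -/
structure MatchInstance where
  σ : ℕ
  w : List (Fin σ)
  p : List (Fin σ)
  gc : Fin (p.length - 1) → RegConstraint σ
  p_pos : 0 < p.length
  p_le : p.length ≤ w.length
  σ_le : σ ≤ w.length

namespace MatchInstance

/-- The question of the matching problem. -/
def Matches (x : MatchInstance) : Prop :=
  IsGapSubseq x.p (fun j => (x.gc j).language) x.w

open Classical in
/-- The total number of states of the DFAs that correspond to non-zero gaps. -/
def states (x : MatchInstance) : ℕ :=
  ∑ j, if (x.gc j).IsZeroGap then 0 else (x.gc j).numStates

/-- The alphabet size, the lengths of `w` and `p`, the letters of `w` and of `p`, and the DFAs. -/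
def encode (x : MatchInstance) : List ℕ :=
  [x.σ, x.w.length, x.p.length]
    ++ x.w.map (fun a => (a : ℕ))
    ++ x.p.map (fun a => (a : ℕ))
    ++ (List.ofFn fun j => (x.gc j).encode).flatten

end MatchInstance

/-- The matching problem with regular constraints, restricted to the instances in `S`, can be
solved in time `O(|w| ^ h * states(gc) ^ g)`, where time linear in the length of the input is
always granted in addition. -/
def MatchSolvable (S : Set MatchInstance) (h g : ℝ) : Prop :=
  ∃ (P : RAM.Program) (C : ℝ),
    RAM.Decides P MatchInstance.encode MatchInstance.Matches S
      (fun x => C * ((x.w.length : ℝ) ^ h * (x.states : ℝ) ^ g + (x.encode.length : ℝ)))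

end

namespace RAM

/-! ### Bounded computations -/

/-! The proof reduces OV to the matching problem and carries out the reduction on the RAM.

The text has n - 1 blocks of zeros, then n blocks spelling the vectors of the first family, then n -
1 blocks of zeros. The pattern consists only of the letter `#`, with d + 1 of them for each vector
of the second family. Inside a vector every gap is a single letter: it must be 0 where the entry is
1, and may be 0 or 1 where the entry is 0. The closing letter of a block is never 0 or 1, which
forces every vector onto exactly one block (`IsEmbedding.position_mod`). A vector fits on a zero
block always, and on a block of the first family iff the two vectors are orthogonal. The n vectors
occupy increasing blocks, so they fit neither entirely before nor entirely after the middle region.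
A gap between two vectors contains at most one separator, and the two separators enclose the middle
region, so that region cannot be jumped over. Hence some vector lands in the middle
(`IsEmbedding.hasOrthogonalPair`). Conversely, an orthogonal pair is placed in the middle and the
zero blocks absorb the other vectors (`HasOrthogonalPair.exists_isEmbedding`).

There are four letters and every automaton has three states. Both |w| and states(gc) lie between n
and 27n(d + 1), so |w|^h * states^g is at most n^(h+g) times a polynomial in d, for exponents of
either sign (`rpow_le_of_between`).

On the machine, each cell of the output is the value of a fixed arithmetic expression in its index,
n, d and the input cells. A loop writes these values above the region of the input, and a second
loop moves them down. This takes time linear in the output and ends in exactly the initial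
configuration of the matching program, which then runs relocated (`Decides.of_translation`). -/

theorem run_add (P : Program) (s t : ℕ) (c : Config) : run P (s + t) c = run P t (run P s c) := by
  unfold run
  rw [Nat.add_comm, Function.iterate_add_apply]

theorem Config.BoundedBy.mono {c : Config} {B B' : ℕ} (h : c.BoundedBy B) (hB : B ≤ B') :
    c.BoundedBy B' :=
  ⟨fun r => (h.1 r).trans hB, fun a => (h.2 a).trans hB⟩

/-- `P` leads from `c` to `c'` in `t` steps, and all numbers on the way are at most `B`. -/
def Steps (P : Program) (B t : ℕ) (c c' : Config) : Prop :=
  run P t c = c' ∧ ∀ s ≤ t, (run P s c).BoundedBy B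

theorem Steps.mono {P : Program} {B B' t : ℕ} {c c' : Config} (h : Steps P B t c c')
    (hB : B ≤ B') : Steps P B' t c c' :=
  ⟨h.1, fun s hs => (h.2 s hs).mono hB⟩

theorem Steps.trans {P : Program} {B s t : ℕ} {c c' c'' : Config} (h : Steps P B s c c')
    (h' : Steps P B t c' c'') : Steps P B (s + t) c c'' := by
  refine ⟨by rw [run_add, h.1, h'.1], fun u hu => ?_⟩
  rcases Nat.le_total u s with hs | hs
  · exact h.2 u hs
  · obtain ⟨v, rfl⟩ := Nat.exists_eq_add_of_le hs
    rw [run_add, h.1]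
    exact h'.2 v (by omega)

theorem Steps.one {P : Program} {B : ℕ} {c c' : Config} (h : step P c = c')
    (hc : c.BoundedBy B) (hc' : c'.BoundedBy B) : Steps P B 1 c c' := by
  refine ⟨h, fun s hs => ?_⟩
  interval_cases s
  · exact hc
  · exact (congrArg (fun x => Config.BoundedBy x B) h).mpr hc'

theorem Steps.refl {P : Program} {B : ℕ} {c : Config} (hc : c.BoundedBy B) : Steps P B 0 c c := by
  refine ⟨rfl, fun s hs => ?_⟩
  interval_cases s
  exact hc

/-! ### Code at an offset -/

/-- The program `P` contains `code` from line `o` on. -/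
def CodeAt (P : Program) (o : ℕ) (code : List Instr) : Prop :=
  ∀ i (h : i < code.length), P[o + i]? = some code[i]

theorem CodeAt.left {P : Program} {o : ℕ} {a b : List Instr} (h : CodeAt P o (a ++ b)) :
    CodeAt P o a := by
  intro i hi
  rw [h i (by simp; omega), List.getElem_append_left hi]

theorem CodeAt.right {P : Program} {o : ℕ} {a b : List Instr} (h : CodeAt P o (a ++ b)) :
    CodeAt P (o + a.length) b := by
  intro i hi
  rw [Nat.add_assoc, h (a.length + i) (by simp; omega)]
  simp

theorem codeAt_zero (a b : List Instr) : CodeAt (a ++ b) 0 a := by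
  intro i hi
  rw [Nat.zero_add, List.getElem?_append_left hi, List.getElem?_eq_getElem hi]

theorem CodeAt.head {P : Program} {o : ℕ} {i : Instr} {l : List Instr} (h : CodeAt P o (i :: l)) :
    P[o]? = some i := by
  exact h 0 (by simp)

theorem CodeAt.tail {P : Program} {o : ℕ} {i : Instr} {l : List Instr} (h : CodeAt P o (i :: l)) :
    CodeAt P (o + 1) l :=
  CodeAt.right (a := [i]) h

theorem step_eq_exec {P : Program} {c : Config} {i : Instr} (h : P[c.pc]? = some i) :
    step P c = i.exec c := by
  simp [step, h]

/-! ### Straight-line code -/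

/-- The values of the operation grow at most polynomially. -/
def BinOp.Tame (o : BinOp) : Prop := ∀ x y, o.eval x y ≤ x * y + x + y

theorem BinOp.tame_add : BinOp.add.Tame := fun x y => by simp only [eval]; nlinarith
theorem BinOp.tame_sub : BinOp.sub.Tame := fun x y => by simp only [eval]; nlinarith [Nat.sub_le x y]
theorem BinOp.tame_mul : BinOp.mul.Tame := fun x y => by simp only [eval]; omega
theorem BinOp.tame_div : BinOp.div.Tame := fun x y => by
  simp only [eval]; nlinarith [Nat.div_le_self x y]
theorem BinOp.tame_mod : BinOp.mod.Tame := fun x y => by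
  simp only [eval]; nlinarith [Nat.mod_le x y]
theorem BinOp.tame_and : BinOp.and.Tame := fun x y => by
  simp only [eval]; nlinarith [Nat.and_le_left (n := x) (m := y)]
theorem BinOp.tame_shiftRight : BinOp.shiftRight.Tame := fun x y => by
  simp only [eval]; nlinarith [Nat.shiftRight_le x y]

/-- Instructions without jumps whose values grow at most polynomially, with constants at most `K`. -/
def Instr.Tame (K : ℕ) : Instr → Prop
  | .const _ k => k ≤ K
  | .op o _ _ _ => o.Tame
  | .load _ _ => True
  | .store _ _ => True
  | .jump _ => False
  | .jumpIfZero _ _ => False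

theorem Instr.Tame.pc_exec {K : ℕ} {i : Instr} (h : i.Tame K) (c : Config) :
    (i.exec c).pc = c.pc + 1 := by
  cases i <;> first | rfl | exact h.elim

/-- For B at least 2, xy + x + y with x, y at most B stays below B ^ 3. -/
theorem Instr.Tame.bounded_exec {K B : ℕ} {i : Instr} (h : i.Tame K) (hK : K ≤ B) (hB : 2 ≤ B)
    {c : Config} (hc : c.BoundedBy B) : (i.exec c).BoundedBy (B ^ 3) := by
  have hBB : B ≤ B ^ 3 := Nat.le_self_pow (by norm_num) B
  have upd : ∀ (f : ℕ → ℕ) (r v : ℕ), (∀ s, f s ≤ B) → v ≤ B ^ 3 →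
      ∀ s, Function.update f r v s ≤ B ^ 3 := by
    intro f r v hf hv s
    by_cases hs : s = r
    · subst hs; simpa using hv
    · simpa [Function.update_of_ne hs] using (hf s).trans hBB
  cases i with
  | const r k => exact ⟨upd _ _ _ hc.1 ((show k ≤ K from h).trans (hK.trans hBB)),
      (hc.mono hBB).2⟩
  | op o r a b =>
    refine ⟨upd _ _ _ hc.1 (((show o.Tame from h) _ _).trans ?_), (hc.mono hBB).2⟩
    have h1 := Nat.mul_le_mul (hc.1 a) (hc.1 b)
    have h2 := hc.1 a
    have h3 := hc.1 b
    calc _ ≤ B * B + B + B := by omega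
      _ ≤ B ^ 3 := by nlinarith [Nat.mul_le_mul hB hB, Nat.mul_le_mul_left (B * B) hB]
  | load r a => exact ⟨upd _ _ _ hc.1 ((hc.2 _).trans hBB), (hc.mono hBB).2⟩
  | store a r => exact ⟨(hc.mono hBB).1, upd _ _ _ hc.2 ((hc.1 _).trans hBB)⟩
  | jump l => exact h.elim
  | jumpIfZero a l => exact h.elim

/-- Execute a list of instructions one after the other. -/
def execList (code : List Instr) (c : Config) : Config := code.foldl (fun c i => i.exec c) c

theorem execList_append (a b : List Instr) (c : Config) :
    execList (a ++ b) c = execList b (execList a c) := by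
  simp [execList]

/-- Each instruction at worst cubes the bound. For fixed code the exponent is therefore a constant,
and a polynomial bound stays polynomial. -/
theorem steps_execList {P : Program} {K : ℕ} (code : List Instr) (c : Config) (B : ℕ)
    (hP : CodeAt P c.pc code) (ht : ∀ i ∈ code, i.Tame K) (hK : K ≤ B) (hB : 2 ≤ B)
    (hc : c.BoundedBy B) :
    Steps P (B ^ 3 ^ code.length) code.length c (execList code c) := by
  induction code generalizing c B with
  | nil => exact (Steps.refl hc).mono (Nat.le_self_pow (by positivity) B)
  | cons i l ih =>
    have hi : i.Tame K := ht i (by simp)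
    have hBB : B ≤ B ^ 3 := Nat.le_self_pow (by norm_num) B
    have h1 := hi.bounded_exec hK hB hc
    have h2 := ih (i.exec c) (B ^ 3) (by rw [hi.pc_exec]; exact hP.tail)
      (fun j hj => ht j (by simp [hj])) (hK.trans hBB) (hB.trans hBB) h1
    rw [← pow_mul, ← pow_succ'] at h2
    have h3 : B ^ 3 ≤ B ^ 3 ^ (l.length + 1) := by
      apply Nat.pow_le_pow_right (by omega)
      exact Nat.le_self_pow (by omega) 3
    have h4 : Steps P (B ^ 3 ^ (l.length + 1)) 1 c (i.exec c) :=
      Steps.one (step_eq_exec hP.head) (hc.mono (hBB.trans h3)) (h1.mono h3)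
    have h5 := h4.trans h2
    rw [Nat.add_comm 1 l.length] at h5
    exact h5

/-! ### Expressions -/

/-- Arithmetic expressions over registers and memory cells. -/
inductive Expr
  | lit (k : ℕ)
  | reg (r : ℕ)
  | bin (o : BinOp) (a b : Expr)
  | load (a : Expr)

namespace Expr

def eval (regs mem : ℕ → ℕ) : Expr → ℕ
  | lit k => k
  | reg r => regs r
  | bin o a b => o.eval (a.eval regs mem) (b.eval regs mem)
  | load a => mem (a.eval regs mem)

/-- All registers mentioned are smaller than `r`. -/
def Below (r : ℕ) : Expr → Prop
  | lit _ => True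
  | reg s => s < r
  | bin _ a b => a.Below r ∧ b.Below r
  | load a => a.Below r

/-- The number of registers needed for the evaluation. -/
def depth : Expr → ℕ
  | lit _ => 1
  | reg _ => 1
  | bin _ a b => max a.depth (b.depth + 1)
  | load a => a.depth

/-- Evaluate the expression into register `r`, using only registers from `r` on. -/
def code : Expr → ℕ → List Instr
  | lit k, r => [.const r k]
  -- The instruction set has no move; the bitwise conjunction of a register with itself copies it.
  | reg s, r => [.op .and r s s]
  | bin o a b, r => a.code r ++ b.code (r + 1) ++ [.op o r r (r + 1)]
  | load a, r => a.code r ++ [.load r r]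

def Tame (K : ℕ) : Expr → Prop
  | lit k => k ≤ K
  | reg _ => True
  | bin o a b => o.Tame ∧ a.Tame K ∧ b.Tame K
  | load a => a.Tame K

theorem Tame.code {K : ℕ} {e : Expr} (h : e.Tame K) (r : ℕ) : ∀ i ∈ e.code r, i.Tame K := by
  induction e generalizing r with
  | lit k => simpa [Expr.code, Instr.Tame] using (show k ≤ K from h)
  | reg s => simpa [Expr.code, Instr.Tame] using BinOp.tame_and
  | bin o a b iha ihb =>
    intro i hi
    simp only [Expr.code, List.mem_append, List.mem_singleton] at hi
    rcases hi with (hi | hi) | rfl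
    · exact iha h.2.1 _ i hi
    · exact ihb h.2.2 _ i hi
    · exact h.1
  | load a ih =>
    intro i hi
    simp only [Expr.code, List.mem_append, List.mem_singleton] at hi
    rcases hi with hi | rfl
    · exact ih h _ i hi
    · trivial

theorem depth_pos (e : Expr) : 0 < e.depth := by
  induction e <;> simp_all [depth]

theorem Below.mono {r s : ℕ} {e : Expr} (h : e.Below r) (hrs : r ≤ s) : e.Below s := by
  induction e with
  | lit k => trivial
  | reg s => exact lt_of_lt_of_le h hrs
  | bin o a b iha ihb => exact ⟨iha h.1, ihb h.2⟩
  | load a ih => exact ih h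

theorem eval_congr {r : ℕ} {e : Expr} (h : e.Below r) {regs regs' : ℕ → ℕ} (mem : ℕ → ℕ)
    (hr : ∀ s < r, regs' s = regs s) : e.eval regs' mem = e.eval regs mem := by
  induction e with
  | lit k => rfl
  | reg s => exact hr s h
  | bin o a b iha ihb => simp only [eval, iha h.1, ihb h.2]
  | load a ih => simp only [eval, ih h]

/-- Evaluation works like a stack growing upwards from `r`: the left operand stays in `r` while the
right one is computed from `r + 1` on. Everything outside the window of `depth` registers is
preserved. -/
theorem execList_code (e : Expr) (r : ℕ) (h : e.Below r) (c : Config) :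
    (execList (e.code r) c).pc = c.pc + (e.code r).length ∧
    (execList (e.code r) c).mem = c.mem ∧
    (execList (e.code r) c).regs r = e.eval c.regs c.mem ∧
    ∀ s, s < r ∨ r + e.depth ≤ s → (execList (e.code r) c).regs s = c.regs s := by
  induction e generalizing r c with
  | lit k =>
    refine ⟨rfl, rfl, by simp [execList, Expr.code, Instr.exec, eval], fun s hs => ?_⟩
    simp only [depth] at hs
    exact Function.update_of_ne (by omega) _ _
  | reg s =>
    refine ⟨rfl, rfl, by simp [execList, Expr.code, Instr.exec, eval, BinOp.eval], fun s hs => ?_⟩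
    simp only [depth] at hs
    exact Function.update_of_ne (by omega) _ _
  | bin o a b iha ihb =>
    obtain ⟨a1, a2, a3, a4⟩ := iha r h.1 c
    obtain ⟨b1, b2, b3, b4⟩ := ihb (r + 1) (h.2.mono (by omega)) (execList (a.code r) c)
    simp only [Expr.code, execList_append]
    generalize execList (a.code r) c = c1 at *
    generalize execList (b.code (r + 1)) c1 = c2 at *
    have hb : b.eval c1.regs c1.mem = b.eval c.regs c.mem := by
      rw [a2]; exact eval_congr h.2 _ fun s hs => a4 s (Or.inl hs)
    refine ⟨?_, ?_, ?_, fun s hs => ?_⟩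
    · simp [execList, Instr.exec, b1, a1]; omega
    · simp [execList, Instr.exec, b2, a2]
    · simp [execList, Instr.exec, eval, b3, b4 r (by omega), a3, hb]
    · have hd := b.depth_pos
      simp only [depth] at hs
      simp only [execList, List.foldl, Instr.exec]
      rw [Function.update_of_ne (by omega), b4 s (by omega), a4 s (by omega)]
  | load a ih =>
    obtain ⟨a1, a2, a3, a4⟩ := ih r h c
    simp only [Expr.code, execList_append]
    generalize execList (a.code r) c = c1 at *
    refine ⟨?_, ?_, ?_, fun s hs => ?_⟩
    · simp [execList, Instr.exec, a1]; omega
    · simp [execList, Instr.exec, a2]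
    · simp [execList, Instr.exec, eval, a2, a3]
    · have hd := a.depth_pos
      simp only [depth] at hs
      simp only [execList, List.foldl, Instr.exec]
      rw [Function.update_of_ne (by omega), a4 s (by omega)]

end Expr

/-! ### Statements

Registers from `4` on are scratch registers; they hold zero before and after every statement. -/

/-- Set the registers `r, …, r + k - 1` to zero. -/
def clear (r : ℕ) : ℕ → List Instr
  | 0 => []
  | k + 1 => clear r k ++ [.const (r + k) 0]

theorem execList_clear (r k : ℕ) (c : Config) :
    (execList (clear r k) c).pc = c.pc + (clear r k).length ∧
    (execList (clear r k) c).mem = c.mem ∧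
    ∀ s, (execList (clear r k) c).regs s = if r ≤ s ∧ s < r + k then 0 else c.regs s := by
  induction k with
  | zero =>
    refine ⟨rfl, rfl, fun s => ?_⟩
    rw [if_neg (by omega)]; rfl
  | succ k ih =>
    obtain ⟨h1, h2, h3⟩ := ih
    simp only [clear, execList_append]
    generalize execList (clear r k) c = c1 at *
    refine ⟨by simp [execList, Instr.exec, h1]; omega, by simp [execList, Instr.exec, h2],
      fun s => ?_⟩
    simp only [execList, List.foldl, Instr.exec]
    by_cases hs : s = r + k
    · subst hs; simp
    · rw [Function.update_of_ne hs, h3]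
      congr 1
      simp only [eq_iff_iff]
      omega

theorem tame_clear (K r k : ℕ) : ∀ i ∈ clear r k, i.Tame K := by
  induction k with
  | zero => simp [clear]
  | succ k ih =>
    intro i hi
    simp only [clear, List.mem_append, List.mem_singleton] at hi
    rcases hi with hi | rfl
    · exact ih i hi
    · exact Nat.zero_le _

/-- `R[r] := e` -/
def setCode (r : ℕ) (e : Expr) : List Instr :=
  e.code 4 ++ [.op .and r 4 4] ++ clear 4 e.depth

/-- `M[a] := e` -/
def storeCode (a e : Expr) : List Instr :=
  a.code 4 ++ e.code 5 ++ [.store 4 5] ++ clear 4 (max a.depth (e.depth + 1))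

theorem execList_setCode {r : ℕ} {e : Expr} (hr : r < 4) (he : e.Below 4) (c : Config)
    (hc : ∀ s, 4 ≤ s → c.regs s = 0) :
    execList (setCode r e) c =
      ⟨c.pc + (setCode r e).length, Function.update c.regs r (e.eval c.regs c.mem), c.mem⟩ := by
  obtain ⟨a1, a2, a3, a4⟩ := e.execList_code 4 he c
  simp only [setCode, execList_append]
  generalize execList (e.code 4) c = c1 at *
  obtain ⟨b1, b2, b3⟩ := execList_clear 4 e.depth (execList [.op .and r 4 4] c1)
  generalize hc3 : execList (clear 4 e.depth) _ = c3 at *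
  obtain ⟨pc, regs, mem⟩ := c3
  simp only [Config.mk.injEq] at *
  refine ⟨?_, ?_, ?_⟩
  · rw [b1]; simp [execList, Instr.exec, a1]; omega
  · funext s
    rw [b3]
    simp only [execList, List.foldl, Instr.exec, BinOp.eval, Nat.and_self]
    by_cases hs : s = r
    · subst hs
      rw [if_neg (by omega)]; simp [a3]
    · rw [Function.update_of_ne hs, Function.update_of_ne hs]
      split_ifs with h
      · rw [hc s h.1]
      · exact a4 s (by omega)
  · rw [b2]; simp [execList, Instr.exec, a2]

theorem execList_storeCode {a e : Expr} (ha : a.Below 4) (he : e.Below 4) (c : Config)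
    (hc : ∀ s, 4 ≤ s → c.regs s = 0) :
    execList (storeCode a e) c =
      ⟨c.pc + (storeCode a e).length, c.regs,
        Function.update c.mem (a.eval c.regs c.mem) (e.eval c.regs c.mem)⟩ := by
  obtain ⟨a1, a2, a3, a4⟩ := a.execList_code 4 ha c
  obtain ⟨d1, d2, d3, d4⟩ := e.execList_code 5 (he.mono (by omega)) (execList (a.code 4) c)
  simp only [storeCode, execList_append]
  generalize execList (a.code 4) c = c1 at *
  generalize execList (e.code 5) c1 = c2 at *
  obtain ⟨b1, b2, b3⟩ := execList_clear 4 (max a.depth (e.depth + 1)) (execList [.store 4 5] c2)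
  generalize hc3 : execList (clear 4 _) _ = c3 at *
  obtain ⟨pc, regs, mem⟩ := c3
  simp only [Config.mk.injEq] at *
  have hd := a.depth_pos
  have heval : e.eval c1.regs c1.mem = e.eval c.regs c.mem := by
    rw [a2]; exact Expr.eval_congr he _ fun s hs => a4 s (Or.inl hs)
  refine ⟨?_, ?_, ?_⟩
  · rw [b1]; simp [execList, Instr.exec, a1, d1]; omega
  · funext s
    rw [b3]
    simp only [execList, List.foldl, Instr.exec]
    split_ifs with h
    · rw [hc s h.1]
    · rw [d4 s (by omega), a4 s (by omega)]
  · rw [b2]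
    simp only [execList, List.foldl, Instr.exec]
    rw [d2, d3, d4 4 (by omega), a3, a2, ← a2, heval, a2]

theorem tame_setCode {K r : ℕ} {e : Expr} (he : e.Tame K) : ∀ i ∈ setCode r e, i.Tame K := by
  intro i hi
  simp only [setCode, List.mem_append, List.mem_singleton] at hi
  rcases hi with (hi | rfl) | hi
  · exact he.code _ i hi
  · exact BinOp.tame_and
  · exact tame_clear _ _ _ i hi

theorem tame_storeCode {K : ℕ} {a e : Expr} (ha : a.Tame K) (he : e.Tame K) :
    ∀ i ∈ storeCode a e, i.Tame K := by
  intro i hi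
  simp only [storeCode, List.mem_append, List.mem_singleton] at hi
  rcases hi with ((hi | hi) | rfl) | hi
  · exact ha.code _ i hi
  · exact he.code _ i hi
  · trivial
  · exact tame_clear _ _ _ i hi

/-! ### Statements and loops as bounded computations -/

/-- Any `m` that dominates the length may be used, so all statements of one program share the bound
`B ^ 3 ^ m`. Since `B` refers to the starting configuration alone, the growth does not accumulate
over the iterations of a loop whose invariant restores `B`. -/
theorem steps_setCode {P : Program} {K B m pc r : ℕ} {e : Expr} {regs mem : ℕ → ℕ}
    (hP : CodeAt P pc (setCode r e)) (hr : r < 4) (he : e.Below 4) (ht : e.Tame K) (hK : K ≤ B)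
    (hB : 2 ≤ B) (hm : (setCode r e).length ≤ m) (hz : ∀ s, 4 ≤ s → regs s = 0)
    (hr' : ∀ s, regs s ≤ B) (hm' : ∀ s, mem s ≤ B) :
    Steps P (B ^ 3 ^ m) (setCode r e).length ⟨pc, regs, mem⟩
      ⟨pc + (setCode r e).length, Function.update regs r (e.eval regs mem), mem⟩ := by
  have h := steps_execList (P := P) (setCode r e) ⟨pc, regs, mem⟩ B hP (tame_setCode ht) hK hB
    ⟨hr', hm'⟩
  rw [execList_setCode hr he _ hz] at h
  exact h.mono (Nat.pow_le_pow_right (by omega) (Nat.pow_le_pow_right (by omega) hm))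

theorem steps_storeCode {P : Program} {K B m pc : ℕ} {a e : Expr} {regs mem : ℕ → ℕ}
    (hP : CodeAt P pc (storeCode a e)) (ha : a.Below 4) (he : e.Below 4) (hta : a.Tame K)
    (ht : e.Tame K) (hK : K ≤ B) (hB : 2 ≤ B) (hm : (storeCode a e).length ≤ m)
    (hz : ∀ s, 4 ≤ s → regs s = 0) (hr' : ∀ s, regs s ≤ B) (hm' : ∀ s, mem s ≤ B) :
    Steps P (B ^ 3 ^ m) (storeCode a e).length ⟨pc, regs, mem⟩
      ⟨pc + (storeCode a e).length, regs,
        Function.update mem (a.eval regs mem) (e.eval regs mem)⟩ := by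
  have h := steps_execList (P := P) (storeCode a e) ⟨pc, regs, mem⟩ B hP (tame_storeCode hta ht)
    hK hB ⟨hr', hm'⟩
  rw [execList_storeCode ha he _ hz] at h
  exact h.mono (Nat.pow_le_pow_right (by omega) (Nat.pow_le_pow_right (by omega) hm))

/-- A loop placed at line `o` that runs as long as `R[1] < R[0]`. -/
def loopCode (o : ℕ) (body : List Instr) : List Instr :=
  [.op .sub 4 0 1, .jumpIfZero 4 (o + (body.length + 4)), .const 4 0] ++ body ++ [.jump o]

theorem length_loopCode (o : ℕ) (body : List Instr) :
    (loopCode o body).length = body.length + 4 := by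
  simp [loopCode]

/-- The sequences `regs` and `mem` are the loop invariant. An iteration costs the body and four
control instructions; leaving the loop costs one more test of two instructions, after which the
scratch register already holds zero. -/
theorem steps_loopCode {P : Program} {o B N t : ℕ} {body : List Instr} {regs mem : ℕ → ℕ → ℕ}
    (hP : CodeAt P o (loopCode o body))
    (h0 : ∀ k ≤ N, regs k 0 = N) (h1 : ∀ k ≤ N, regs k 1 = k) (h4 : ∀ k ≤ N, regs k 4 = 0)
    (hr : ∀ k ≤ N, ∀ s, regs k s ≤ B) (hm : ∀ k ≤ N, ∀ s, mem k s ≤ B)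
    (hbody : ∀ k < N, Steps P B t ⟨o + 3, regs k, mem k⟩
      ⟨o + 3 + body.length, regs (k + 1), mem (k + 1)⟩) :
    Steps P B (N * (t + 4) + 2) ⟨o, regs 0, mem 0⟩
      ⟨o + (body.length + 4), regs N, mem N⟩ := by
  have hP0 : P[o]? = some (.op .sub 4 0 1) := hP.head
  have hP1 : P[o + 1]? = some (.jumpIfZero 4 (o + (body.length + 4))) := hP.tail.head
  have hP2 : P[o + 2]? = some (.const 4 0) := hP.tail.tail.head
  have hP3 : P[o + 3 + body.length]? = some (.jump o) := by
    have := hP.right.head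
    rwa [List.length_append, ← Nat.add_assoc] at this
  have hNB : N ≤ B := by simpa [h0 0 (Nat.zero_le N)] using hr 0 (Nat.zero_le N) 0
  have upd : ∀ k ≤ N, ∀ v ≤ B, ∀ s, Function.update (regs k) 4 v s ≤ B := by
    intro k hk v hv s
    by_cases hs : s = 4
    · subst hs; simpa using hv
    · simpa [Function.update_of_ne hs] using hr k hk s
  have test : ∀ k ≤ N, Steps P B 1 ⟨o, regs k, mem k⟩
      ⟨o + 1, Function.update (regs k) 4 (N - k), mem k⟩ := by
    intro k hk
    refine Steps.one ?_ ⟨hr k hk, hm k hk⟩ ⟨upd k hk _ (by omega), hm k hk⟩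
    rw [step_eq_exec (i := .op .sub 4 0 1) hP0]
    simp [Instr.exec, BinOp.eval, h0 k hk, h1 k hk]
  have iter : ∀ k < N, Steps P B (t + 4) ⟨o, regs k, mem k⟩ ⟨o, regs (k + 1), mem (k + 1)⟩ := by
    intro k hk
    have e1 : Steps P B 1 ⟨o + 1, Function.update (regs k) 4 (N - k), mem k⟩
        ⟨o + 2, Function.update (regs k) 4 (N - k), mem k⟩ := by
      refine Steps.one ?_ ⟨upd k hk.le _ (by omega), hm k hk.le⟩
        ⟨upd k hk.le _ (by omega), hm k hk.le⟩
      rw [step_eq_exec (i := .jumpIfZero 4 _) hP1]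
      simp [Instr.exec, show N - k ≠ 0 by omega]
    have e2 : Steps P B 1 ⟨o + 2, Function.update (regs k) 4 (N - k), mem k⟩
        ⟨o + 3, regs k, mem k⟩ := by
      refine Steps.one ?_ ⟨upd k hk.le _ (by omega), hm k hk.le⟩ ⟨hr k hk.le, hm k hk.le⟩
      rw [step_eq_exec (i := .const 4 0) hP2]
      have := h4 k hk.le
      simp [Instr.exec, ← this]
    have e3 : Steps P B 1 ⟨o + 3 + body.length, regs (k + 1), mem (k + 1)⟩
        ⟨o, regs (k + 1), mem (k + 1)⟩ := by
      refine Steps.one ?_ ⟨hr _ hk, hm _ hk⟩ ⟨hr _ hk, hm _ hk⟩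
      rw [step_eq_exec (i := .jump o) hP3]
      rfl
    have := ((((test k hk.le).trans e1).trans e2).trans (hbody k hk)).trans e3
    rwa [show 1 + 1 + 1 + t + 1 = t + 4 by omega] at this
  have all : ∀ k ≤ N, Steps P B (k * (t + 4)) ⟨o, regs 0, mem 0⟩ ⟨o, regs k, mem k⟩ := by
    intro k
    induction k with
    | zero =>
      intro _
      rw [Nat.zero_mul]
      exact Steps.refl ⟨hr 0 (Nat.zero_le N), hm 0 (Nat.zero_le N)⟩
    | succ k ih =>
      intro hk
      have := (ih (by omega)).trans (iter k hk)
      rwa [← Nat.succ_mul] at this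
  refine (all N le_rfl).trans ((test N le_rfl).trans (t := 1) ?_)
  have hu : Function.update (regs N) 4 (N - N) = regs N := by
    rw [Nat.sub_self, ← h4 N le_rfl, Function.update_eq_self]
  rw [hu]
  refine Steps.one ?_ ⟨hr N le_rfl, hm N le_rfl⟩ ⟨hr N le_rfl, hm N le_rfl⟩
  rw [step_eq_exec (i := .jumpIfZero 4 _) hP1]
  simp [Instr.exec, h4 N le_rfl]

/-! ### Relocation of programs -/

/-- Move the targets of jumps by `o` lines. -/
def Instr.shift (o : ℕ) : Instr → Instr
  | .jump l => .jump (l + o)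
  | .jumpIfZero a l => .jumpIfZero a (l + o)
  | i => i

theorem Instr.exec_shift (o : ℕ) (i : Instr) (c : Config) :
    (i.shift o).exec ⟨c.pc + o, c.regs, c.mem⟩ =
      ⟨(i.exec c).pc + o, (i.exec c).regs, (i.exec c).mem⟩ := by
  cases i <;> simp [shift, exec, Nat.add_right_comm]
  split_ifs <;> omega

/-- Lines and jump targets are moved by the same amount, so the relocated program mirrors `P` step
by step and never enters `Q`. Lines outside `P` become lines outside the whole program, so halting
is mirrored as well. -/
theorem step_relocate (Q P : Program) (c : Config) :
    step (Q ++ P.map (Instr.shift Q.length)) ⟨c.pc + Q.length, c.regs, c.mem⟩ =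
      ⟨(step P c).pc + Q.length, (step P c).regs, (step P c).mem⟩ := by
  have h : (Q ++ P.map (Instr.shift Q.length))[c.pc + Q.length]? =
      P[c.pc]?.map (Instr.shift Q.length) := by
    rw [List.getElem?_append_right (by omega)]; simp
  cases hi : P[c.pc]? with
  | none => simp [step, h, hi]
  | some i =>
    rw [step_eq_exec (i := i.shift Q.length) (by simpa [hi] using h), step_eq_exec hi,
      Instr.exec_shift]

theorem run_relocate (Q P : Program) (t : ℕ) (c : Config) :
    run (Q ++ P.map (Instr.shift Q.length)) t ⟨c.pc + Q.length, c.regs, c.mem⟩ =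
      ⟨(run P t c).pc + Q.length, (run P t c).regs, (run P t c).mem⟩ := by
  induction t generalizing c with
  | zero => rfl
  | succ t ih =>
    simp only [run, Function.iterate_succ_apply] at ih ⊢
    rw [step_relocate, ih]

/-- Deciding a problem by translating its instances into instances of another problem. -/
theorem Decides.of_translation {Q P : Program} {ι κ : Type} {enc : ι → List ℕ}
    {enc' : κ → List ℕ} {yes : ι → Prop} {yes' : κ → Prop} {S : Set ι} {S' : Set κ} {T' : κ → ℝ}
    (f : ι → κ) (time : ι → ℕ) (b b' : ℕ)
    (hS : ∀ x ∈ S, f x ∈ S') (hyes : ∀ x ∈ S, (yes' (f x) ↔ yes x))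
    (hlen : ∀ x ∈ S, (enc' (f x)).length + 2 ≤ ((enc x).length + 2) ^ b')
    (hQ : ∀ x ∈ S, Steps (Q ++ P.map (Instr.shift Q.length)) (((enc x).length + 2) ^ b) (time x)
      (init (enc x)) ⟨Q.length, (init (enc' (f x))).regs, (init (enc' (f x))).mem⟩)
    (hP : Decides P enc' yes' S' T') :
    Decides (Q ++ P.map (Instr.shift Q.length)) enc yes S (fun x => time x + T' (f x)) := by
  obtain ⟨c, hc⟩ := hP
  -- The first summand covers the translation, the second one the run of `P`, whose bound is a power
  -- of the length of the translated input.
  refine ⟨b + b' * c, fun x hx => ?_⟩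
  obtain ⟨t, ht, hh, ha, hb⟩ := hc (f x) (hS x hx)
  have hr := fun s => run_relocate Q P s (init (enc' (f x)))
  have hpc : (init (enc' (f x))).pc + Q.length = Q.length := Nat.zero_add _
  rw [hpc] at hr
  have hsteps : Steps (Q ++ P.map (Instr.shift Q.length)) (((enc x).length + 2) ^ (b + b' * c)) t
      ⟨Q.length, (init (enc' (f x))).regs, (init (enc' (f x))).mem⟩
      (run (Q ++ P.map (Instr.shift Q.length)) t
        ⟨Q.length, (init (enc' (f x))).regs, (init (enc' (f x))).mem⟩) := by
    refine ⟨rfl, fun s hs => ?_⟩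
    rw [hr]
    refine Config.BoundedBy.mono (c := ⟨_, _, _⟩) (hb s hs) ?_
    calc _ ≤ (((enc x).length + 2) ^ b') ^ c := Nat.pow_le_pow_left (hlen x hx) c
      _ = ((enc x).length + 2) ^ (b' * c) := (pow_mul _ _ _).symm
      _ ≤ _ := Nat.pow_le_pow_right (by omega) (by omega)
  have key := ((hQ x hx).mono (Nat.pow_le_pow_right (by omega) (Nat.le_add_right b (b' * c)))).trans
    hsteps
  refine ⟨time x + t, by push_cast; linarith, ?_, ?_, key.2⟩
  · rw [key.1, hr]
    simp only [Halted, List.length_append, List.length_map] at hh ⊢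
    omega
  · rw [key.1, hr, ← hyes x hx]
    exact ha

end RAM

/-! ### From orthogonal vectors to matching: the instance

The text consists of `3n - 2` blocks `#x₁#x₂…#x_d#y`, where `#` is the letter `2`. The blocks
`n - 1, …, 2n - 2` carry the vectors of the first family, all others carry zeros. The last letter `y`
of a block is the separator `3` for the blocks `n - 2` and `2n - 2`, and `#` for all others. The
pattern is `#^(n(d+1))`; its gaps describe the vectors of the second family. -/

namespace OVInstance

/-- The entry `k` of the vector `i`, as a number, and `0` outside the range. -/
def bit {n d : ℕ} (A : Fin n → Fin d → Bool) (i k : ℕ) : ℕ :=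
  if h : i < n ∧ k < d then (A ⟨i, h.1⟩ ⟨k, h.2⟩).toNat else 0

theorem bit_le_one {n d : ℕ} (A : Fin n → Fin d → Bool) (i k : ℕ) : bit A i k ≤ 1 := by
  unfold bit
  split_ifs
  · exact Bool.toNat_le _
  · exact Nat.zero_le _

theorem bit_of_lt {n d : ℕ} (A : Fin n → Fin d → Bool) {i k : ℕ} (hi : i < n) (hk : k < d) :
    bit A i k = (A ⟨i, hi⟩ ⟨k, hk⟩).toNat := dif_pos ⟨hi, hk⟩

theorem bit_of_le {n d : ℕ} (A : Fin n → Fin d → Bool) {i : ℕ} (k : ℕ) (hi : n ≤ i) :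
    bit A i k = 0 := dif_neg (by omega)

/-- The letter at position `r` of block `b` of the text. -/
def blockLetter (x : OVInstance) (b r : ℕ) : ℕ :=
  if r % 2 = 0 then 2
  else if r = 2 * x.d + 1 then (if b + 2 = x.n then 3 else if b + 2 = 2 * x.n then 3 else 2)
  else if b + 1 < x.n then 0 else bit x.A (b + 1 - x.n) (r / 2)

/-- The letter at position `i` of the text. -/
def textLetter (x : OVInstance) (i : ℕ) : ℕ :=
  x.blockLetter (i / (2 * x.d + 2)) (i % (2 * x.d + 2))

def textLength (x : OVInstance) : ℕ := (3 * x.n - 2) * (2 * x.d + 2)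

def patternLength (x : OVInstance) : ℕ := x.n * (x.d + 1)

/-- The kind of the gap `j`: gaps of the kinds `0` and `1` stand for entries of vectors of the second
family, gaps of kind `2` separate two vectors. -/
def gapKind (x : OVInstance) (j : ℕ) : ℕ :=
  if j % (x.d + 1) = x.d then 2 else bit x.B (j / (x.d + 1)) (j % (x.d + 1))

theorem blockLetter_lt (x : OVInstance) (b r : ℕ) : x.blockLetter b r < 4 := by
  have := bit_le_one x.A (b + 1 - x.n) (r / 2)
  unfold blockLetter
  split_ifs <;> omega

theorem textLetter_lt (x : OVInstance) (i : ℕ) : x.textLetter i < 4 := x.blockLetter_lt _ _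

theorem textLetter_block (x : OVInstance) (b : ℕ) {r : ℕ} (hr : r < 2 * x.d + 2) :
    x.textLetter (b * (2 * x.d + 2) + r) = x.blockLetter b r := by
  rw [textLetter, Nat.mul_comm b, Nat.mul_add_div (by omega), Nat.mul_add_mod,
    Nat.div_eq_of_lt hr, Nat.mod_eq_of_lt hr, Nat.add_zero]

theorem gapKind_inner (x : OVInstance) (j : ℕ) {k : ℕ} (hk : k < x.d) :
    x.gapKind (j * (x.d + 1) + k) = bit x.B j k := by
  rw [gapKind, Nat.mul_comm j, Nat.mul_add_div (by omega), Nat.mul_add_mod,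
    Nat.div_eq_of_lt (by omega), Nat.mod_eq_of_lt (by omega), if_neg (by omega), Nat.add_zero]

theorem gapKind_outer (x : OVInstance) (j : ℕ) : x.gapKind (j * (x.d + 1) + x.d) = 2 := by
  rw [gapKind, Nat.mul_comm j, Nat.mul_add_mod, Nat.mod_eq_of_lt (by omega), if_pos rfl]

theorem gapKind_le (x : OVInstance) (j : ℕ) : x.gapKind j ≤ 2 := by
  have := bit_le_one x.B (j / (x.d + 1)) (j % (x.d + 1))
  unfold gapKind
  split_ifs <;> omega

/-- An embedding of the pattern into the text, described by numbers. -/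
structure IsEmbedding (x : OVInstance) (e : ℕ → ℕ) : Prop where
  strictMono : ∀ i j, i < j → j < x.patternLength → e i < e j
  lt_length : ∀ i < x.patternLength, e i < x.textLength
  letter : ∀ i < x.patternLength, x.textLetter (e i) = 2
  entry : ∀ j, j + 1 < x.patternLength → x.gapKind j ≠ 2 →
    e (j + 1) = e j + 2 ∧ x.textLetter (e j + 1) ≤ 1 - x.gapKind j
  separator : ∀ j, j + 1 < x.patternLength → x.gapKind j = 2 → ∀ s t, e j < s → s < t →
    t < e (j + 1) → x.textLetter s = 3 → x.textLetter t = 3 → False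

theorem patternLength_index (x : OVInstance) {j k : ℕ} (hj : j < x.n) (hk : k ≤ x.d) :
    j * (x.d + 1) + k < x.patternLength := by
  have := Nat.mul_le_mul_right (x.d + 1) (Nat.succ_le_of_lt hj)
  rw [Nat.succ_mul] at this
  unfold patternLength
  omega

/-! ### From an embedding to an orthogonal pair -/

namespace IsEmbedding

variable {x : OVInstance} {e : ℕ → ℕ}

theorem entry_index (h : x.IsEmbedding e) {j k : ℕ} (hj : j < x.n) (hk : k < x.d) :
    e (j * (x.d + 1) + k + 1) = e (j * (x.d + 1) + k) + 2 ∧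
      x.textLetter (e (j * (x.d + 1) + k) + 1) ≤ 1 - bit x.B j k := by
  have := bit_le_one x.B j k
  rw [← x.gapKind_inner j hk]
  exact h.entry _ (x.patternLength_index hj hk) (by rw [x.gapKind_inner j hk]; omega)

theorem position_index (h : x.IsEmbedding e) {j k : ℕ} (hj : j < x.n) (hk : k ≤ x.d) :
    e (j * (x.d + 1) + k) = e (j * (x.d + 1)) + 2 * k := by
  induction k with
  | zero => rfl
  | succ k ih => rw [← Nat.add_assoc, (h.entry_index hj hk).1, ih (by omega)]; ring

/-- Every vector of the second family is matched with a whole block. -/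
theorem position_mod (h : x.IsEmbedding e) {j : ℕ} (hj : j < x.n) :
    e (j * (x.d + 1)) % (2 * x.d + 2) = 0 := by
  have hd := x.d_pos
  by_contra hq
  have hq' := Nat.mod_lt (e (j * (x.d + 1))) (show 0 < 2 * x.d + 2 by omega)
  have hdm := Nat.div_add_mod' (e (j * (x.d + 1))) (2 * x.d + 2)
  -- The `d` gaps of vector `j` are the single letters at every second position after its start, and
  -- each must be 0 or 1.
  have hl : ∀ k < x.d, x.textLetter (e (j * (x.d + 1)) + 2 * k + 1) ≤ 1 := by
    intro k hk
    have := (h.entry_index hj hk).2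
    rw [h.position_index hj hk.le] at this
    omega
  generalize e (j * (x.d + 1)) / (2 * x.d + 2) = b at *
  generalize e (j * (x.d + 1)) % (2 * x.d + 2) = q at *
  generalize e (j * (x.d + 1)) = p at *
  subst hdm
  -- A nonzero even offset makes one of these gaps hit the closing letter of the block, at offset `2
  -- * x.d + 1`; an odd offset makes the first gap hit a `#` at an even offset, possibly the first
  -- letter of the next block.
  rcases Nat.mod_two_eq_zero_or_one q with h2 | h2
  · have := hl ((2 * x.d - q) / 2) (by omega)
    rw [show b * (2 * x.d + 2) + q + 2 * ((2 * x.d - q) / 2) + 1 =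
      b * (2 * x.d + 2) + (2 * x.d + 1) by omega, x.textLetter_block b (by omega), blockLetter,
      if_neg (by omega), if_pos rfl] at this
    split_ifs at this <;> omega
  · have := hl 0 hd
    rcases Nat.lt_or_ge (q + 1) (2 * x.d + 2) with h3 | h3
    · rw [show b * (2 * x.d + 2) + q + 2 * 0 + 1 = b * (2 * x.d + 2) + (q + 1) by omega,
        x.textLetter_block b h3, blockLetter, if_pos (by omega)] at this
      omega
    · rw [show b * (2 * x.d + 2) + q + 2 * 0 + 1 = (b + 1) * (2 * x.d + 2) + 0 by
        rw [Nat.succ_mul b]; omega, x.textLetter_block _ (by omega), blockLetter, if_pos rfl] at this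
      omega

theorem exists_block (h : x.IsEmbedding e) : ∃ β : ℕ → ℕ, ∀ j < x.n, ∀ k ≤ x.d,
    e (j * (x.d + 1) + k) = β j * (2 * x.d + 2) + 2 * k := by
  refine ⟨fun j => e (j * (x.d + 1)) / (2 * x.d + 2), fun j hj k hk => ?_⟩
  have := Nat.div_add_mod' (e (j * (x.d + 1))) (2 * x.d + 2)
  rw [h.position_mod hj, Nat.add_zero] at this
  rw [h.position_index hj hk, this]

/-- The vector sought is the first one whose block is not among the initial `n - 1` zero blocks; it
cannot lie beyond the middle region either. -/
theorem hasOrthogonalPair (h : x.IsEmbedding e) : x.HasOrthogonalPair := by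
  obtain ⟨β, hβ⟩ := h.exists_block
  have hn := x.n_pos
  have hd := x.d_pos
  have hβ0 : ∀ j < x.n, e (j * (x.d + 1)) = β j * (2 * x.d + 2) := fun j hj => by
    simpa using hβ j hj 0 (Nat.zero_le _)
  have hmono : ∀ j, j + 1 < x.n → β j < β (j + 1) := by
    intro j hj
    have h1 := h.strictMono (j * (x.d + 1)) ((j + 1) * (x.d + 1)) (by rw [Nat.succ_mul]; omega)
      (by simpa using x.patternLength_index hj (Nat.zero_le _))
    rw [hβ0 j (by omega), hβ0 (j + 1) hj] at h1
    exact lt_of_mul_lt_mul_right h1 (Nat.zero_le _)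
  have hge : ∀ j < x.n, β 0 + j ≤ β j := by
    intro j
    induction j with
    | zero => intro _; omega
    | succ j ih =>
      intro hj
      have h1 := ih (by omega)
      have h2 := hmono j hj
      omega
  have hlast : β (x.n - 1) < 3 * x.n - 2 := by
    have h1 := h.lt_length ((x.n - 1) * (x.d + 1))
      (by simpa using x.patternLength_index (Nat.sub_lt hn one_pos) (Nat.zero_le _))
    rw [hβ0 _ (Nat.sub_lt hn one_pos), textLength] at h1
    exact lt_of_mul_lt_mul_right h1 (Nat.zero_le _)
  have hex : ∃ j, j < x.n ∧ x.n ≤ β j + 1 := ⟨x.n - 1, Nat.sub_lt hn one_pos, by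
    have := hge (x.n - 1) (by omega); omega⟩
  classical
  obtain ⟨hj, hj1⟩ := Nat.find_spec hex
  have hmin := fun i => Nat.find_min hex (m := i)
  generalize Nat.find hex = j at *
  -- If `j = 0`, starting beyond the middle would leave too few blocks for all `n` vectors.
  -- Otherwise the preceding vector lies before the middle, and a jump over the middle would put
  -- both separators into one gap.
  have hup : β j + 1 < 2 * x.n := by
    rcases j with _ | j
    · have := hge (x.n - 1) (by omega)
      omega
    · have h0 : β j + 1 < x.n := by
        have := hmin j (Nat.lt_succ_self j)
        omega
      by_contra hup
      have e1 := hβ j (by omega) x.d le_rfl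
      have e2 := hβ0 (j + 1) hj
      have hidx : j * (x.d + 1) + x.d + 1 = (j + 1) * (x.d + 1) := by rw [Nat.succ_mul]; omega
      have sep : ∀ b, b + 2 = x.n ∨ b + 2 = 2 * x.n →
          x.textLetter (b * (2 * x.d + 2) + (2 * x.d + 1)) = 3 := by
        intro b hb
        rw [x.textLetter_block b (by omega), blockLetter, if_neg (by omega), if_pos rfl]
        split_ifs <;> first | rfl | omega
      have m1 := Nat.mul_le_mul_right (2 * x.d + 2) (show β j ≤ x.n - 2 by omega)
      have m2 := Nat.mul_le_mul_right (2 * x.d + 2) (show x.n - 2 + 1 ≤ 2 * x.n - 2 by omega)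
      have m3 := Nat.mul_le_mul_right (2 * x.d + 2) (show 2 * x.n - 2 + 1 ≤ β (j + 1) by omega)
      rw [Nat.succ_mul] at m2 m3
      refine h.separator (j * (x.d + 1) + x.d) ?_ (x.gapKind_outer j)
        ((x.n - 2) * (2 * x.d + 2) + (2 * x.d + 1))
        ((2 * x.n - 2) * (2 * x.d + 2) + (2 * x.d + 1)) ?_ ?_ ?_ (sep _ (by omega))
        (sep _ (by omega))
      · rw [hidx]; simpa using x.patternLength_index hj (Nat.zero_le _)
      · omega
      · omega
      · rw [hidx]; omega
  refine ⟨⟨β j + 1 - x.n, by omega⟩, ⟨j, hj⟩, fun k => ?_⟩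
  have h1 := (h.entry_index hj k.2).2
  rw [hβ j hj k k.2.le, Nat.add_assoc, x.textLetter_block _ (by omega), blockLetter,
    if_neg (by omega), if_neg (by omega), if_neg (by omega),
    show (2 * (k : ℕ) + 1) / 2 = k by omega, bit_of_lt x.A (by omega) k.2,
    bit_of_lt x.B hj k.2] at h1
  have h2 := Bool.toNat_le (x.B ⟨j, hj⟩ k)
  -- Where the entry of the second vector is 1, the gap admits only the letter 0, and this letter is
  -- the entry of the first vector.
  rcases Nat.le_one_iff_eq_zero_or_eq_one.1 h2 with h3 | h3
  · rw [h3, Nat.mul_zero]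
  · simp only [Fin.eta, h3, Nat.sub_self, Nat.le_zero] at h1
    rw [h1, Nat.zero_mul]

end IsEmbedding

/-- The block with which the vector `j` of the second family is matched, if the vector `i₀` of the
first family is orthogonal to the vector `j₀` of the second one. -/
def targetBlock (x : OVInstance) (i₀ j₀ j : ℕ) : ℕ :=
  if j < j₀ then j else if j = j₀ then x.n - 1 + i₀ else 2 * x.n - 2 + (j - j₀)

/-- The vectors before `j₀` use the leading zero blocks, `j₀` uses the block of `i₀`, and the later
ones use the trailing zero blocks. There are `n - 1` zero blocks on each side, enough for every
`j₀`. -/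
theorem HasOrthogonalPair.exists_isEmbedding {x : OVInstance} (h : x.HasOrthogonalPair) :
    ∃ e, x.IsEmbedding e := by
  obtain ⟨i₀, j₀, hij⟩ := h
  have hd := x.d_pos
  set β := x.targetBlock i₀ j₀ with hβ
  have hi₀ := i₀.2
  have hj₀ := j₀.2
  have hmono : ∀ j, β j < β (j + 1) := by
    intro j
    simp only [hβ, targetBlock]
    split_ifs <;> omega
  have hlt : ∀ j < x.n, β j < 3 * x.n - 2 := by
    intro j hj
    simp only [hβ, targetBlock]
    split_ifs <;> omega
  -- No two consecutive vectors lie on opposite sides of the middle region, because `j₀` sits inside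
  -- it.
  have hcross : ∀ j, j + 1 < x.n → β j + 2 ≤ x.n → 2 * x.n ≤ β (j + 1) + 1 → False := by
    intro j hj
    simp only [hβ, targetBlock]
    split_ifs <;> omega
  have hzero : ∀ j < x.n, ∀ k < x.d, x.blockLetter (β j) (2 * k + 1) ≤ 1 - bit x.B j k := by
    intro j hj k hk
    rw [blockLetter, if_neg (by omega), if_neg (by omega)]
    split_ifs with h1
    · exact Nat.zero_le _
    · by_cases h2 : j = j₀
      · have := hij ⟨k, hk⟩
        have h3 : β j + 1 - x.n = i₀ := by
          simp only [hβ, targetBlock, h2]; simp; omega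
        rw [h3, show (2 * k + 1) / 2 = k by omega, bit_of_lt x.A hi₀ hk, bit_of_lt x.B hj hk]
        subst h2
        have a1 := Bool.toNat_le (x.A i₀ ⟨k, hk⟩)
        rcases Nat.mul_eq_zero.1 this with h4 | h4
        · simp only [Fin.eta, h4]; exact Nat.zero_le _
        · simp only [Fin.eta] at h4 ⊢; rw [h4]; exact a1
      -- Only a vector after `j₀` remains; its block lies beyond the first family, where the entries
      -- default to 0.
      · rw [bit_of_le]
        · exact Nat.zero_le _
        · simp only [hβ, targetBlock] at h1 ⊢
          split_ifs at h1 ⊢ <;> omega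
  set S := 2 * x.d + 2 with hS
  have hdiv : ∀ j k, k ≤ x.d → (j * (x.d + 1) + k) / (x.d + 1) = j ∧
      (j * (x.d + 1) + k) % (x.d + 1) = k := fun j k hk => by
    rw [Nat.mul_comm j, Nat.mul_add_div (by omega), Nat.mul_add_mod,
      Nat.div_eq_of_lt (by omega), Nat.mod_eq_of_lt (by omega)]
    simp
  have hex : ∀ i, ∃ j k, k ≤ x.d ∧ i = j * (x.d + 1) + k := fun i =>
    ⟨i / (x.d + 1), i % (x.d + 1), Nat.le_of_lt_succ (Nat.mod_lt _ (by omega)),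
      (Nat.div_add_mod' _ _).symm⟩
  have hjn : ∀ j k, j * (x.d + 1) + k < x.patternLength → j < x.n := by
    intro j k hjk
    exact lt_of_mul_lt_mul_right (lt_of_le_of_lt (Nat.le_add_right _ k) hjk) (Nat.zero_le _)
  let e : ℕ → ℕ := fun i => β (i / (x.d + 1)) * S + 2 * (i % (x.d + 1))
  have he : ∀ j k, k ≤ x.d → e (j * (x.d + 1) + k) = β j * S + 2 * k := by
    intro j k hk
    simp only [e, hdiv j k hk]
  have he' : ∀ j, e (j * (x.d + 1) + x.d + 1) = β (j + 1) * S := by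
    intro j
    have := he (j + 1) 0 (Nat.zero_le _)
    rwa [Nat.succ_mul, Nat.mul_zero, Nat.add_zero, Nat.add_zero] at this
  have hstep : ∀ i, e i < e (i + 1) := by
    intro i
    obtain ⟨j, k, hk, rfl⟩ := hex i
    rcases hk.lt_or_eq with hk' | rfl
    · rw [he j k hk, Nat.add_assoc, he j (k + 1) hk']; omega
    · rw [he j _ le_rfl, he' j]
      have := Nat.mul_le_mul_right S (hmono j)
      rw [Nat.succ_mul] at this
      omega
  refine ⟨e, fun i j hij _ => strictMono_nat_of_lt_succ hstep hij, fun i hi => ?_, fun i hi => ?_,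
    fun i hi hk2 => ?_, fun i hi hk2 s t hs hst ht h3 h3' => ?_⟩
  · obtain ⟨j, k, hk, rfl⟩ := hex i
    rw [he j k hk, textLength, ← hS]
    have := Nat.mul_le_mul_right S (hlt j (hjn j k hi))
    rw [Nat.succ_mul] at this
    omega
  · obtain ⟨j, k, hk, rfl⟩ := hex i
    rw [he j k hk, x.textLetter_block _ (by omega), blockLetter, if_pos (by omega)]
  · obtain ⟨j, k, hk, rfl⟩ := hex i
    rcases hk.lt_or_eq with hk' | rfl
    · rw [x.gapKind_inner j hk', he j k hk, Nat.add_assoc, he j (k + 1) hk',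
        Nat.add_assoc (β j * S) (2 * k) 1, x.textLetter_block _ (by omega)]
      exact ⟨by ring, hzero j (hjn j k (by omega)) k hk'⟩
    · exact absurd (x.gapKind_outer j) hk2
  · obtain ⟨j, k, hk, rfl⟩ := hex i
    rcases hk.lt_or_eq with hk' | rfl
    · rw [x.gapKind_inner j hk'] at hk2
      have := bit_le_one x.B j k
      omega
    · rw [he j _ le_rfl] at hs
      rw [he' j] at ht
      have hsep : ∀ u, x.textLetter u = 3 → ∃ b, u = b * S + (2 * x.d + 1) ∧
          (b + 2 = x.n ∨ b + 2 = 2 * x.n) := by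
        intro u hu
        refine ⟨u / S, ?_⟩
        have h4 := Nat.div_add_mod' u S
        rw [textLetter, blockLetter, ← hS] at hu
        have h5 := bit_le_one x.A (u / S + 1 - x.n) (u % S / 2)
        split_ifs at hu <;> omega
      have hj : j + 1 < x.n := hjn (j + 1) 0 (by rw [Nat.succ_mul]; omega)
      obtain ⟨b, rfl, hb⟩ := hsep s h3
      obtain ⟨b', rfl, hb'⟩ := hsep t h3'
      have c1 : β j ≤ b := by
        by_contra hc
        have := Nat.mul_le_mul_right S (Nat.lt_of_not_le hc)
        rw [Nat.succ_mul] at this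
        omega
      have c2 : b' < β (j + 1) := by
        by_contra hc
        have := Nat.mul_le_mul_right S (Nat.le_of_not_lt hc)
        omega
      -- Two separators inside the gap must be the two different ones, which `hcross` excludes.
      have c3 : b < b' := lt_of_mul_lt_mul_right (show b * S < b' * S by omega) (Nat.zero_le _)
      exact hcross j hj (by omega) (by omega)

end OVInstance

noncomputable section

/-! ### The gap constraints -/

/-- The transition function of the automaton for gaps of kind `τ`. -/
def gapStep (τ s a : ℕ) : ℕ :=
  if τ = 2 then (if a = 3 then min (s + 1) 2 else s) else if s = 0 ∧ a ≤ 1 - τ then 1 else 2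

/-- The accepting states of the automaton for gaps of kind `τ`. -/
def GapAccept (τ s : ℕ) : Prop := if τ = 2 then s ≤ 1 else s = 1

instance (τ s : ℕ) : Decidable (GapAccept τ s) := by unfold GapAccept; infer_instance

theorem gapStep_lt (τ : ℕ) {s : ℕ} (hs : s < 3) (a : ℕ) : gapStep τ s a < 3 := by
  unfold gapStep
  split_ifs <;> omega

/-- For `τ = 0, 1`, the automaton accepts the single letters that are at most `1 - τ`; for `τ = 2`,
the words with at most one letter `3`. -/
def gapDFA (τ : ℕ) : DFA (Fin 4) (Fin 3) where
  step s a := ⟨gapStep τ s a, gapStep_lt τ s.2 a⟩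
  start := 0
  accept := {s | GapAccept τ s}

def gapConstraint (τ : ℕ) : RegConstraint 4 := ⟨3, gapDFA τ⟩

theorem gapDFA_evalFrom_cons (τ : ℕ) (s : Fin 3) (a : Fin 4) (v : List (Fin 4)) :
    (gapDFA τ).evalFrom s (a :: v) = (gapDFA τ).evalFrom ⟨gapStep τ s a, gapStep_lt τ s.2 a⟩ v :=
  rfl

theorem mem_gapConstraint_two (v : List (Fin 4)) :
    v ∈ (gapConstraint 2).language ↔ v.count 3 ≤ 1 := by
  have key : ∀ (v : List (Fin 4)) (s : Fin 3),
      ((gapDFA 2).evalFrom s v : ℕ) = min (s + v.count 3) 2 := by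
    intro v
    induction v with
    | nil => intro s; simp [DFA.evalFrom_nil]; omega
    | cons a v ih =>
      intro s
      rw [gapDFA_evalFrom_cons, ih, List.count_cons]
      simp only [gapStep, if_pos]
      have h3 : (a == 3) = true ↔ (a : ℕ) = 3 := by
        rw [beq_iff_eq, Fin.ext_iff]; rfl
      by_cases h : (a : ℕ) = 3
      · rw [if_pos h, if_pos (h3.2 h)]; omega
      · rw [if_neg h, if_neg (fun h' => h (h3.1 h'))]; omega
  change GapAccept 2 ((gapDFA 2).evalFrom 0 v : ℕ) ↔ _
  rw [key v 0, GapAccept, if_pos rfl]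
  simp

theorem mem_gapConstraint {τ : ℕ} (hτ : τ ≠ 2) (v : List (Fin 4)) :
    v ∈ (gapConstraint τ).language ↔ ∃ a : Fin 4, v = [a] ∧ (a : ℕ) ≤ 1 - τ := by
  -- State 2 is a sink, and every letter read in state 1 leads to it.
  have key : ∀ (v : List (Fin 4)) (s : Fin 3), s ≠ 0 → v ≠ [] →
      ((gapDFA τ).evalFrom s v : ℕ) = 2 := by
    intro v
    induction v with
    | nil => intro s _ h; exact absurd rfl h
    | cons a v ih =>
      intro s hs _
      have hs' : gapStep τ s a = 2 := by
        have : (s : ℕ) ≠ 0 := fun h => hs (Fin.ext h)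
        simp [gapStep, hτ, this]
      rw [gapDFA_evalFrom_cons]
      rcases v with _ | ⟨b, v⟩
      · exact hs'
      · exact ih _ (fun h => by simpa [hs'] using congrArg Fin.val h) (by simp)
  change GapAccept τ ((gapDFA τ).evalFrom 0 v : ℕ) ↔ _
  rw [GapAccept, if_neg hτ]
  match v with
  | [] => simp
  | [a] =>
    rw [gapDFA_evalFrom_cons]
    by_cases h : (a : ℕ) ≤ 1 - τ <;> simp [gapStep, hτ, h]
  | a :: b :: t =>
    rw [gapDFA_evalFrom_cons, key (b :: t) _ _ (by simp)]
    · simp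
    · intro h
      have := congrArg Fin.val h
      simp only [gapStep, if_neg hτ] at this
      split_ifs at this <;> simp at this

/-- Every one of these automata accepts the one-letter word 0, so all of them count towards
`states`. -/
theorem gapConstraint_not_isZeroGap (τ : ℕ) : ¬ (gapConstraint τ).IsZeroGap := by
  intro h
  by_cases hτ : τ = 2
  · subst hτ
    have := (h [0]).1 ((mem_gapConstraint_two _).2 (by decide))
    simp at this
  · have := (h [0]).1 ((mem_gapConstraint hτ _).2 ⟨0, rfl, Nat.zero_le _⟩)
    simp at this

/-! ### Factors of a word -/

theorem gapWord_getElem? {α : Type} (w : List α) (a b i : ℕ) :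
    (gapWord w a b)[i]? = if a + 1 + i < b then w[a + 1 + i]? else none := by
  rw [gapWord, List.getElem?_drop, List.getElem?_take]

theorem gapWord_eq_singleton {α : Type} {w : List α} {a b : ℕ} (hab : a < b) (hb : b ≤ w.length)
    (c : α) : gapWord w a b = [c] ↔ b = a + 2 ∧ w[a + 1]? = some c := by
  constructor
  · intro h
    have hl := congrArg List.length h
    simp only [gapWord, List.length_drop, List.length_take, List.length_singleton] at hl
    have hba : b = a + 2 := by omega
    have h0 := congrArg (·[0]?) h
    simp only [gapWord_getElem?] at h0
    rw [if_pos (by omega)] at h0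
    exact ⟨hba, h0⟩
  · rintro ⟨rfl, h⟩
    apply List.ext_getElem?
    intro i
    rw [gapWord_getElem?]
    rcases i with _ | i
    · rw [if_pos (by omega)]; exact h
    · rw [if_neg (by omega)]; simp

theorem count_gapWord_le_one {α : Type} [DecidableEq α] {w : List α} {a b : ℕ} (c : α) :
    (gapWord w a b).count c ≤ 1 ↔
      ∀ s t, a < s → s < t → t < b → w[s]? = some c → w[t]? = some c → False := by
  rw [← not_lt, ← Nat.succ_le_iff, ← List.duplicate_iff_two_le_count,
    List.duplicate_iff_exists_distinct_get]
  constructor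
  · intro h s t hs hst ht h1 h2
    apply h
    have e1 : (gapWord w a b)[s - (a + 1)]? = some c := by
      rw [gapWord_getElem?, show a + 1 + (s - (a + 1)) = s by omega, if_pos (by omega), h1]
    have e2 : (gapWord w a b)[t - (a + 1)]? = some c := by
      rw [gapWord_getElem?, show a + 1 + (t - (a + 1)) = t by omega, if_pos (by omega), h2]
    obtain ⟨l1, e1⟩ := List.getElem?_eq_some_iff.1 e1
    obtain ⟨l2, e2⟩ := List.getElem?_eq_some_iff.1 e2
    exact ⟨⟨_, l1⟩, ⟨_, l2⟩, Fin.mk_lt_mk.2 (by omega), e1.symm, e2.symm⟩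
  · rintro h ⟨⟨s, hs⟩, ⟨t, ht⟩, hst, h1, h2⟩
    have hst := Fin.mk_lt_mk.1 hst
    have e1 := List.getElem?_eq_some_iff.2 ⟨hs, h1.symm⟩
    have e2 := List.getElem?_eq_some_iff.2 ⟨ht, h2.symm⟩
    rw [gapWord_getElem?] at e1 e2
    split_ifs at e1 e2 with l1 l2
    exact h (a + 1 + s) (a + 1 + t) (by omega) (by omega) l2 e1 e2

/-! ### The translation -/

namespace OVInstance

theorem patternLength_pos (x : OVInstance) : 0 < x.patternLength :=
  Nat.mul_pos x.n_pos (Nat.succ_pos _)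

theorem patternLength_le (x : OVInstance) : x.patternLength ≤ x.textLength := by
  have := x.n_pos
  exact Nat.mul_le_mul (by omega) (by omega)

theorem four_le_textLength (x : OVInstance) : 4 ≤ x.textLength := by
  have := x.n_pos
  have := x.d_pos
  calc 4 = 1 * 4 := rfl
    _ ≤ _ := Nat.mul_le_mul (by omega) (by omega)

def text (x : OVInstance) : List (Fin 4) :=
  List.ofFn fun i : Fin x.textLength => ⟨x.textLetter i, x.textLetter_lt i⟩

def pattern (x : OVInstance) : List (Fin 4) := List.replicate x.patternLength 2

theorem length_text (x : OVInstance) : x.text.length = x.textLength := by simp [text]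

theorem length_pattern (x : OVInstance) : x.pattern.length = x.patternLength := by simp [pattern]

/-- The instance of the matching problem that corresponds to an instance of OV. -/
def toMatch (x : OVInstance) : MatchInstance where
  σ := 4
  w := x.text
  p := x.pattern
  gc := fun j => gapConstraint (x.gapKind j)
  p_pos := x.length_pattern ▸ x.patternLength_pos
  p_le := by rw [length_pattern, length_text]; exact x.patternLength_le
  σ_le := by rw [length_text]; exact x.four_le_textLength

theorem text_getElem? (x : OVInstance) {i : ℕ} (hi : i < x.textLength) :
    x.text[i]? = some (⟨x.textLetter i, x.textLetter_lt i⟩ : Fin 4) := by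
  rw [text, List.getElem?_ofFn, dif_pos hi]

theorem text_getElem?_eq_some_iff (x : OVInstance) {i : ℕ} (hi : i < x.textLength) (a : Fin 4) :
    x.text[i]? = some a ↔ x.textLetter i = a := by
  rw [x.text_getElem? hi, Option.some_inj, Fin.ext_iff]

theorem gapWord_mem_iff (x : OVInstance) {j a b : ℕ} (hab : a < b) (hb : b < x.textLength) :
    gapWord x.text a b ∈ (gapConstraint (x.gapKind j)).language ↔
      (x.gapKind j ≠ 2 → b = a + 2 ∧ x.textLetter (a + 1) ≤ 1 - x.gapKind j) ∧
      (x.gapKind j = 2 → ∀ s t, a < s → s < t → t < b → x.textLetter s = 3 →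
        x.textLetter t = 3 → False) := by
  by_cases hk : x.gapKind j = 2
  · rw [hk, mem_gapConstraint_two, count_gapWord_le_one]
    simp only [ne_eq, not_true_eq_false, false_imp_iff, true_and, true_imp_iff]
    refine forall_congr' fun s => forall_congr' fun t => ?_
    constructor
    · intro h h1 h2 h3 h4 h5
      exact h h1 h2 h3 ((x.text_getElem?_eq_some_iff (by omega) 3).2 h4)
        ((x.text_getElem?_eq_some_iff (by omega) 3).2 h5)
    · intro h h1 h2 h3 h4 h5
      exact h h1 h2 h3 ((x.text_getElem?_eq_some_iff (by omega) 3).1 h4)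
        ((x.text_getElem?_eq_some_iff (by omega) 3).1 h5)
  · rw [mem_gapConstraint hk]
    simp only [hk, ne_eq, not_false_eq_true, true_imp_iff, false_imp_iff, and_true]
    have hs := gapWord_eq_singleton (w := x.text) hab (by rw [length_text]; omega)
    constructor
    · rintro ⟨c, h1, h2⟩
      obtain ⟨rfl, h3⟩ := (hs c).1 h1
      rw [x.text_getElem?_eq_some_iff (by omega)] at h3
      exact ⟨rfl, h3 ▸ h2⟩
    · rintro ⟨rfl, h2⟩
      exact ⟨_, (hs _).2 ⟨rfl, x.text_getElem? (by omega)⟩, h2⟩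

theorem isGapSubseq_iff (x : OVInstance) :
    IsGapSubseq x.pattern (fun j => (gapConstraint (x.gapKind j)).language) x.text ↔
      x.HasOrthogonalPair := by
  have hw := x.length_text
  have hp := x.length_pattern
  constructor
  · rintro ⟨e, he, hl, hg⟩
    -- The value 0 beyond the pattern is arbitrary; `IsEmbedding` inspects only indices below
    -- `patternLength`.
    let e' : ℕ → ℕ := fun i => if h : i < x.pattern.length then (e ⟨i, h⟩ : ℕ) else 0
    have he' : ∀ i (h : i < x.pattern.length), e' i = e ⟨i, h⟩ := fun i h => dif_pos h
    have hlt : ∀ i < x.patternLength, e' i < x.textLength := by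
      intro i hi
      rw [he' i (by omega), ← hw]
      exact (e _).2
    have hmono : ∀ i j, i < j → j < x.patternLength → e' i < e' j := by
      intro i j hij hj
      rw [he' i (by omega), he' j (by omega)]
      exact he (Fin.mk_lt_mk.2 hij)
    have hgap : ∀ j, j + 1 < x.patternLength →
        gapWord x.text (e' j) (e' (j + 1)) ∈ (gapConstraint (x.gapKind j)).language := by
      intro j hj
      rw [he' j (by omega), he' (j + 1) (by omega)]
      exact hg ⟨j, by omega⟩
    refine IsEmbedding.hasOrthogonalPair (e := e') ⟨hmono, hlt, fun i hi => ?_, fun j hj => ?_,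
      fun j hj => ?_⟩
    · have h1 := hl ⟨i, by omega⟩
      refine (x.text_getElem?_eq_some_iff (hlt i hi) 2).1 ?_
      rw [he' i (by omega), List.getElem?_eq_getElem (e _).2]
      refine congrArg some (h1.trans ?_)
      simp [pattern]
    · exact ((x.gapWord_mem_iff (hmono j _ (Nat.lt_succ_self j) hj) (hlt _ hj)).1 (hgap j hj)).1
    · exact ((x.gapWord_mem_iff (hmono j _ (Nat.lt_succ_self j) hj) (hlt _ hj)).1 (hgap j hj)).2
  · intro h
    obtain ⟨e, he⟩ := h.exists_isEmbedding
    refine ⟨fun i => ⟨e i, hw ▸ he.lt_length i (hp ▸ i.2)⟩, fun i j hij =>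
      Fin.mk_lt_mk.2 (he.strictMono i j hij (hp ▸ j.2)), fun i => ?_, fun j => ?_⟩
    · have h1 := (x.text_getElem?_eq_some_iff (he.lt_length i (hp ▸ i.2)) 2).2
        (he.letter i (hp ▸ i.2))
      rw [List.getElem?_eq_getElem (hw ▸ he.lt_length i (hp ▸ i.2)), Option.some_inj] at h1
      exact h1.trans (List.eq_of_mem_replicate (List.get_mem _ _)).symm
    · have hj : (j : ℕ) + 1 < x.patternLength := by have := j.2; omega
      exact (x.gapWord_mem_iff (he.strictMono _ _ (Nat.lt_succ_self _) hj) (he.lt_length _ hj)).2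
        ⟨he.entry j hj, he.separator j hj⟩

theorem matches_toMatch_iff (x : OVInstance) : x.toMatch.Matches ↔ x.HasOrthogonalPair :=
  x.isGapSubseq_iff

theorem states_toMatch (x : OVInstance) : x.toMatch.states = 3 * (x.patternLength - 1) := by
  have h : ∀ j, ¬ (x.toMatch.gc j).IsZeroGap := fun j => gapConstraint_not_isZeroGap _
  have h' : ∀ j, (x.toMatch.gc j).numStates = 3 := fun j => rfl
  have h'' : x.toMatch.p.length = x.patternLength := x.length_pattern
  simp only [MatchInstance.states, h, h', if_false, Finset.sum_const, Finset.card_univ,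
    Fintype.card_fin, h'', smul_eq_mul, mul_comm]

end OVInstance
end

noncomputable section

/-! ### The encoding of the translated instance -/

/-- The cell `r` of the encoding of the automaton for gaps of kind `τ`. -/
def gapCell (τ r : ℕ) : ℕ :=
  if r = 0 then 3 else if r = 1 then 0
  else if r < 5 then (if GapAccept τ (r - 2) then 1 else 0)
  else gapStep τ ((r - 5) / 4) ((r - 5) % 4)

open Classical in
theorem encode_mk {σ m : ℕ} (M : DFA (Fin σ) (Fin m)) :
    (RegConstraint.mk m M).encode = [m, (M.start : ℕ)] ++
      (List.ofFn fun s => if s ∈ M.accept then 1 else 0) ++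
      (List.ofFn fun s => List.ofFn fun a => (M.step s a : ℕ)).flatten := rfl

theorem encode_gapConstraint (τ : ℕ) :
    (gapConstraint τ).encode = List.ofFn fun r : Fin 17 => gapCell τ r := by
  rw [gapConstraint, encode_mk]
  simp [gapDFA, gapCell, List.ofFn_succ]
  congr

/-- The digits of this number in base `4` are the encodings of the automata for the three kinds of
gaps. -/
def gapTable : ℕ := 3378744590979234657450458780739

/-- All cells are at most 3 and each encoding has 2 + 3 + 12 = 17 of them, so digit `17 * τ + r` is
read off by a shift of two bits per digit and a remainder modulo 4. -/
theorem gapTable_spec : ∀ τ < 3, ∀ r < 17, gapTable >>> (2 * (17 * τ + r)) % 4 = gapCell τ r := by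
  decide

theorem List.getElem?_flatten_of_length {α : Type*} (L : List (List α)) {m : ℕ}
    (h : ∀ l ∈ L, l.length = m) {r : ℕ} (hr : r < m) (i : ℕ) :
    L.flatten[i * m + r]? = L[i]?.bind (·[r]?) := by
  induction L generalizing i with
  | nil => simp
  | cons l L ih =>
    have hl : l.length = m := h l (by simp)
    rw [List.flatten_cons]
    rcases i with _ | i
    · rw [List.getElem?_append_left (by omega)]; simp
    · rw [List.getElem?_append_right (by rw [hl, Nat.succ_mul]; omega), hl, Nat.succ_mul,
        show i * m + m + r - m = i * m + r by omega, ih fun l' hl' => h l' (by simp [hl'])]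
      simp

namespace OVInstance

/-- The length of the encoding of the translated instance. -/
def outLength (x : OVInstance) : ℕ :=
  3 + x.textLength + x.patternLength + (x.patternLength - 1) * 17

/-- The cell `i` of the encoding of the translated instance. -/
def outCell (x : OVInstance) (i : ℕ) : ℕ :=
  if i < 3 then (if i < 1 then 4 else if i < 2 then x.textLength else x.patternLength)
  else if i < 3 + x.textLength then x.textLetter (i - 3)
  else if i < 3 + x.textLength + x.patternLength then 2
  else gapCell (x.gapKind ((i - (3 + x.textLength + x.patternLength)) / 17))
    ((i - (3 + x.textLength + x.patternLength)) % 17)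

theorem encode_toMatch (x : OVInstance) : x.toMatch.encode =
    [4, x.textLength, x.patternLength] ++ (List.ofFn fun i : Fin x.textLength => x.textLetter i) ++
      List.replicate x.patternLength 2 ++
      (List.ofFn fun j : Fin (x.pattern.length - 1) =>
        List.ofFn fun r : Fin 17 => gapCell (x.gapKind j) r).flatten := by
  have h : x.toMatch.encode = [4, x.text.length, x.pattern.length]
      ++ x.text.map (fun a => (a : ℕ)) ++ x.pattern.map (fun a => (a : ℕ))
      ++ (List.ofFn fun j : Fin (x.pattern.length - 1) =>
        (gapConstraint (x.gapKind j)).encode).flatten := rfl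
  rw [h]
  -- The coercion of a list of letters to a list of numbers can unfold to a bind over singletons,
  -- which is the same as mapping `Fin.val`.
  have hf : ∀ l : List (Fin 4), l.flatMap (fun a : Fin 4 => [a.val]) = l.map Fin.val := fun l => by
    induction l with
    | nil => rfl
    | cons a l ih => rw [List.flatMap_cons, ih]; rfl
  simp only [encode_gapConstraint, length_text, length_pattern, List.bind_eq_flatMap,
    List.pure_def, List.map_id_fun', id_eq, hf]
  simp only [text, pattern, List.map_ofFn, List.map_replicate]
  rfl

theorem length_encode_toMatch (x : OVInstance) : x.toMatch.encode.length = x.outLength := by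
  simp [encode_toMatch, outLength, length_pattern, List.length_flatten, List.map_ofFn,
    Function.comp_def]
  ring

theorem getD_encode_toMatch (x : OVInstance) {i : ℕ} (hi : i < x.outLength) :
    x.toMatch.encode.getD i 0 = x.outCell i := by
  rw [encode_toMatch, outCell, List.getD_eq_getElem?_getD]
  unfold outLength at hi
  split_ifs with h1 h2 h3 h4 h5
  · obtain rfl : i = 0 := by omega
    rfl
  · obtain rfl : i = 1 := by omega
    rfl
  · obtain rfl : i = 2 := by omega
    rfl
  · rw [List.getElem?_append_left (by simp; omega), List.getElem?_append_left (by simp; omega),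
      List.getElem?_append_right (by simp; omega), List.getElem?_ofFn]
    simp only [List.length_cons, List.length_nil]
    rw [dif_pos (by omega)]; rfl
  · rw [List.getElem?_append_left (by simp; omega), List.getElem?_append_right (by simp; omega),
      List.getElem?_replicate, if_pos (by simp; omega)]
    rfl
  · rw [List.getElem?_append_right (by simp; omega)]
    have hl : i - ([4, x.textLength, x.patternLength] ++
        (List.ofFn fun i : Fin x.textLength => x.textLetter i) ++
        List.replicate x.patternLength 2).length =
        i - (3 + x.textLength + x.patternLength) := by simp; omega
    rw [hl]
    generalize hk : i - (3 + x.textLength + x.patternLength) = k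
    have hk' : k / 17 < x.pattern.length - 1 := by rw [length_pattern]; omega
    conv_lhs => rw [← Nat.div_add_mod' k 17]
    rw [List.getElem?_flatten_of_length _ (by simp) (Nat.mod_lt _ (by norm_num)),
      List.getElem?_ofFn, dif_pos hk', Option.bind_some, List.getElem?_ofFn,
      dif_pos (Nat.mod_lt _ (by norm_num))]
    rfl

theorem length_encode (x : OVInstance) : x.encode.length = 2 + 2 * (x.n * x.d) := by
  simp [encode, List.length_flatten, List.map_ofFn, Function.comp_def]
  ring

theorem index_lt {n d i k : ℕ} (hi : i < n) (hk : k < d) : i * d + k < n * d := by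
  have := Nat.mul_le_mul_right d (Nat.succ_le_of_lt hi)
  rw [Nat.succ_mul] at this
  omega

theorem getD_flatten_bits {n d : ℕ} (A : Fin n → Fin d → Bool) {i k : ℕ} (hi : i < n)
    (hk : k < d) :
    (List.ofFn fun i => List.ofFn fun k => (A i k).toNat).flatten[i * d + k]? =
      some (bit A i k) := by
  rw [List.getElem?_flatten_of_length _ (by simp) hk, List.getElem?_ofFn, dif_pos hi,
    bit_of_lt A hi hk]
  simp [hk]

theorem getD_encode_A (x : OVInstance) {i k : ℕ} (hi : i < x.n) (hk : k < x.d) :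
    x.encode.getD (2 + (i * x.d + k)) 0 = bit x.A i k := by
  have := index_lt hi hk
  rw [List.getD_eq_getElem?_getD, encode, List.getElem?_append_left (by
    simp [List.length_flatten, List.map_ofFn, Function.comp_def]; omega),
    List.getElem?_append_right (by simp)]
  simp only [List.length_cons, List.length_nil]
  rw [show 2 + (i * x.d + k) - (0 + 1 + 1) = i * x.d + k by omega, getD_flatten_bits x.A hi hk]
  rfl

theorem getD_encode_B (x : OVInstance) {i k : ℕ} (hi : i < x.n) (hk : k < x.d) :
    x.encode.getD (2 + x.n * x.d + (i * x.d + k)) 0 = bit x.B i k := by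
  have hl : ([x.n, x.d] ++ (List.ofFn fun i => List.ofFn fun k => (x.A i k).toNat).flatten).length
      = 2 + x.n * x.d := by
    simp [List.length_flatten, List.map_ofFn, Function.comp_def]; omega
  rw [List.getD_eq_getElem?_getD, encode, List.getElem?_append_right (by rw [hl]; omega), hl,
    Nat.add_sub_cancel_left, getD_flatten_bits x.B hi hk]
  rfl

/-- The entries are bits, and `n` and `d` are at most `n * d` because both are positive. -/
theorem getD_encode_le (x : OVInstance) (a : ℕ) : x.encode.getD a 0 ≤ x.encode.length := by
  have hn := x.n_pos
  have hd := x.d_pos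
  have h1 : x.n ≤ x.n * x.d := Nat.le_mul_of_pos_right _ hd
  have h2 : x.d ≤ x.n * x.d := Nat.le_mul_of_pos_left _ hn
  have hb : ∀ v ∈ x.encode, v ≤ x.encode.length := by
    rw [length_encode]
    intro v hv
    simp only [encode, List.mem_append, List.mem_cons, List.not_mem_nil, or_false,
      List.mem_flatten, List.mem_ofFn] at hv
    rcases hv with ((rfl | rfl) | ⟨l, ⟨i, rfl⟩, hv⟩) | ⟨l, ⟨i, rfl⟩, hv⟩
    · omega
    · omega
    · obtain ⟨k, rfl⟩ := (List.mem_ofFn' _ _).1 hv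
      exact (Bool.toNat_le (x.A i k)).trans (by omega)
    · obtain ⟨k, rfl⟩ := (List.mem_ofFn' _ _).1 hv
      exact (Bool.toNat_le (x.B i k)).trans (by omega)
  rcases Nat.lt_or_ge a x.encode.length with h | h
  · rw [List.getD_eq_getElem _ _ h]
    exact hb _ (List.getElem_mem h)
  · rw [List.getD_eq_default _ _ h]
    exact Nat.zero_le _

theorem outCell_le (x : OVInstance) (i : ℕ) : x.outCell i ≤ x.outLength := by
  have h1 := x.four_le_textLength
  have h2 : ∀ τ ≤ 2, ∀ r < 17, gapCell τ r < 4 := fun τ hτ r hr => by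
    rw [← gapTable_spec τ (by omega) r hr]
    exact Nat.mod_lt _ (by norm_num)
  have h3 := x.textLetter_lt (i - 3)
  have h4 := h2 (x.gapKind ((i - (3 + x.textLength + x.patternLength)) / 17)) (x.gapKind_le _)
    ((i - (3 + x.textLength + x.patternLength)) % 17) (Nat.mod_lt _ (by norm_num))
  unfold outCell outLength
  split_ifs <;> omega

end OVInstance
end

noncomputable section

/-! ### The program for the translation -/

namespace RAM.Expr

instance : Add Expr := ⟨bin .add⟩
instance : Sub Expr := ⟨bin .sub⟩
instance : Mul Expr := ⟨bin .mul⟩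
instance : Div Expr := ⟨bin .div⟩
instance : Mod Expr := ⟨bin .mod⟩
instance (k : ℕ) : OfNat Expr k := ⟨lit k⟩

section eval

variable (regs mem : ℕ → ℕ) (a b c d : Expr) (k : ℕ)

theorem eval_add : (a + b).eval regs mem = a.eval regs mem + b.eval regs mem := rfl
theorem eval_sub : (a - b).eval regs mem = a.eval regs mem - b.eval regs mem := rfl
theorem eval_mul : (a * b).eval regs mem = a.eval regs mem * b.eval regs mem := rfl
theorem eval_div : (a / b).eval regs mem = a.eval regs mem / b.eval regs mem := rfl
theorem eval_mod : (a % b).eval regs mem = a.eval regs mem % b.eval regs mem := rfl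
theorem eval_ofNat : (ofNat(k) : Expr).eval regs mem = OfNat.ofNat k := rfl
theorem eval_lit : (lit k).eval regs mem = k := rfl
theorem eval_bin (o : BinOp) :
    (bin o a b).eval regs mem = o.eval (a.eval regs mem) (b.eval regs mem) := rfl
theorem eval_load : (load a).eval regs mem = mem (a.eval regs mem) := rfl

/-- If `c` is zero then `a` else `b`. -/
def ifZero (c a b : Expr) : Expr := (1 - c) * a + (1 - (1 - c)) * b

def ifLt (c d a b : Expr) : Expr := ifZero (d - c) b a

def ifEq (c d a b : Expr) : Expr := ifZero ((c - d) + (d - c)) a b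

/-- With truncated subtraction, `1 - c` is the indicator of `c = 0`, so a case distinction needs no
jump. Both branches are evaluated, which is harmless since a load at a meaningless address still
yields some number. -/
theorem eval_ifZero : (ifZero c a b).eval regs mem =
    if c.eval regs mem = 0 then a.eval regs mem else b.eval regs mem := by
  simp only [ifZero, eval_add, eval_mul, eval_sub, eval_ofNat]
  split_ifs with h
  · simp [h]
  · simp [show 1 - c.eval regs mem = 0 by omega]

theorem eval_ifLt : (ifLt c d a b).eval regs mem =
    if c.eval regs mem < d.eval regs mem then a.eval regs mem else b.eval regs mem := by
  rw [ifLt, eval_ifZero, eval_sub]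
  split_ifs <;> first | rfl | omega

theorem eval_ifEq : (ifEq c d a b).eval regs mem =
    if c.eval regs mem = d.eval regs mem then a.eval regs mem else b.eval regs mem := by
  rw [ifEq, eval_ifZero, eval_add, eval_sub, eval_sub]
  split_ifs <;> first | rfl | omega

end eval

/-- An expression that can be compiled: it does not mention scratch registers, its values grow at
most polynomially, and its constants are at most `K`. -/
def Good (K : ℕ) (e : Expr) : Prop := e.Below 4 ∧ e.Tame K

section good

variable {K : ℕ} {a b c d : Expr}

theorem Good.add (ha : a.Good K) (hb : b.Good K) : (a + b).Good K :=
  ⟨⟨ha.1, hb.1⟩, BinOp.tame_add, ha.2, hb.2⟩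
theorem Good.sub (ha : a.Good K) (hb : b.Good K) : (a - b).Good K :=
  ⟨⟨ha.1, hb.1⟩, BinOp.tame_sub, ha.2, hb.2⟩
theorem Good.mul (ha : a.Good K) (hb : b.Good K) : (a * b).Good K :=
  ⟨⟨ha.1, hb.1⟩, BinOp.tame_mul, ha.2, hb.2⟩
theorem Good.div (ha : a.Good K) (hb : b.Good K) : (a / b).Good K :=
  ⟨⟨ha.1, hb.1⟩, BinOp.tame_div, ha.2, hb.2⟩
theorem Good.mod (ha : a.Good K) (hb : b.Good K) : (a % b).Good K :=
  ⟨⟨ha.1, hb.1⟩, BinOp.tame_mod, ha.2, hb.2⟩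
theorem Good.shiftRight (ha : a.Good K) (hb : b.Good K) : (bin .shiftRight a b).Good K :=
  ⟨⟨ha.1, hb.1⟩, BinOp.tame_shiftRight, ha.2, hb.2⟩
theorem Good.load (ha : a.Good K) : (load a).Good K := ha
theorem good_ofNat {k : ℕ} (hk : k ≤ K) : (OfNat.ofNat k : Expr).Good K := ⟨trivial, hk⟩
theorem good_reg {r : ℕ} (hr : r < 4) : (reg r).Good K := ⟨hr, trivial⟩

theorem Good.ifZero (hK : 1 ≤ K) (hc : c.Good K) (ha : a.Good K) (hb : b.Good K) :
    (ifZero c a b).Good K :=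
  (((good_ofNat hK).sub hc).mul ha).add (((good_ofNat hK).sub ((good_ofNat hK).sub hc)).mul hb)
theorem Good.ifLt (hK : 1 ≤ K) (hc : c.Good K) (hd : d.Good K) (ha : a.Good K) (hb : b.Good K) :
    (ifLt c d a b).Good K :=
  (hd.sub hc).ifZero hK hb ha
theorem Good.ifEq (hK : 1 ≤ K) (hc : c.Good K) (hd : d.Good K) (ha : a.Good K) (hb : b.Good K) :
    (ifEq c d a b).Good K :=
  ((hc.sub hd).add (hd.sub hc)).ifZero hK ha hb

end good

end RAM.Expr

/-! ### The cells of the output as expressions -/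

namespace RAM.Translation

open RAM.Expr

/-! The registers hold the length of the output, the loop index, and the numbers `n` and `d`. -/

def textLengthE : Expr := (3 * reg 2 - 2) * (2 * reg 3 + 2)

def patternLengthE : Expr := reg 2 * (reg 3 + 1)

def outLengthE : Expr :=
  3 + textLengthE + patternLengthE + (patternLengthE - 1) * 17

def blockLetterE (b r : Expr) : Expr :=
  ifEq (r % 2) 0 2
    (ifEq r (2 * reg 3 + 1) (ifEq (b + 2) (reg 2) 3 (ifEq (b + 2) (2 * reg 2) 3 2))
      (ifLt (b + 1) (reg 2) 0
        (ifLt (b + 1) (2 * reg 2) (load (2 + ((b + 1 - reg 2) * reg 3 + r / 2))) 0)))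

def textLetterE (i : Expr) : Expr :=
  blockLetterE (i / (2 * reg 3 + 2)) (i % (2 * reg 3 + 2))

def gapKindE (j : Expr) : Expr :=
  ifEq (j % (reg 3 + 1)) (reg 3) 2
    (load (2 + reg 2 * reg 3 + (j / (reg 3 + 1) * reg 3 + j % (reg 3 + 1))))

def gapCellE (τ r : Expr) : Expr := bin .shiftRight (lit gapTable) (2 * (17 * τ + r)) % 4

def outCellE : Expr :=
  ifLt (reg 1) 3 (ifLt (reg 1) 1 4 (ifLt (reg 1) 2 textLengthE patternLengthE))
    (ifLt (reg 1) (3 + textLengthE) (textLetterE (reg 1 - 3))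
      (ifLt (reg 1) (3 + textLengthE + patternLengthE) 2
        (gapCellE (gapKindE ((reg 1 - (3 + textLengthE + patternLengthE)) / 17))
          ((reg 1 - (3 + textLengthE + patternLengthE)) % 17))))

/-- The values of the registers between two statements. -/
def regsOf (a b c d : ℕ) : ℕ → ℕ := fun r =>
  if r = 0 then a else if r = 1 then b else if r = 2 then c else if r = 3 then d else 0

theorem regsOf_le {a b c d B : ℕ} (ha : a ≤ B) (hb : b ≤ B) (hc : c ≤ B) (hd : d ≤ B) (r : ℕ) :
    regsOf a b c d r ≤ B := by
  unfold regsOf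
  split_ifs <;> omega

theorem regsOf_of_le (a b c d : ℕ) {r : ℕ} (hr : 4 ≤ r) : regsOf a b c d r = 0 := by
  unfold regsOf
  split_ifs <;> omega

theorem update_regsOf_zero (a b c d v : ℕ) :
    Function.update (regsOf a b c d) 0 v = regsOf v b c d := by
  funext r
  by_cases h : r = 0
  · subst h; simp [regsOf]
  · simp [regsOf, h]

theorem update_regsOf_one (a b c d v : ℕ) :
    Function.update (regsOf a b c d) 1 v = regsOf a v c d := by
  funext r
  by_cases h : r = 1
  · subst h; simp [regsOf]
  · simp [regsOf, h]

theorem update_regsOf_two (a b c d v : ℕ) :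
    Function.update (regsOf a b c d) 2 v = regsOf a b v d := by
  funext r
  by_cases h : r = 2
  · subst h; simp [regsOf]
  · simp [regsOf, h]

theorem update_regsOf_three (a b c d v : ℕ) :
    Function.update (regsOf a b c d) 3 v = regsOf a b c v := by
  funext r
  by_cases h : r = 3
  · subst h; simp [regsOf]
  · simp [regsOf, h]

section eval

variable (x : OVInstance) (L i : ℕ) (mem : ℕ → ℕ)

theorem eval_reg_one (a b c d : ℕ) : (reg 1).eval (regsOf a b c d) mem = b := rfl
theorem eval_reg_two (a b c d : ℕ) : (reg 2).eval (regsOf a b c d) mem = c := rfl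
theorem eval_reg_three (a b c d : ℕ) : (reg 3).eval (regsOf a b c d) mem = d := rfl

theorem eval_textLengthE : textLengthE.eval (regsOf L i x.n x.d) mem = x.textLength := rfl

theorem eval_patternLengthE : patternLengthE.eval (regsOf L i x.n x.d) mem = x.patternLength := rfl

theorem eval_outLengthE : outLengthE.eval (regsOf L i x.n x.d) mem = x.outLength := rfl

variable {mem}

theorem eval_blockLetterE (hmem : ∀ a < x.encode.length, mem a = x.encode.getD a 0)
    {b r : Expr} {b' r' : ℕ} (hb : b.eval (regsOf L i x.n x.d) mem = b')
    (hr : r.eval (regsOf L i x.n x.d) mem = r') (hlt : r' < 2 * x.d + 2) :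
    (blockLetterE b r).eval (regsOf L i x.n x.d) mem = x.blockLetter b' r' := by
  simp only [blockLetterE, eval_ifEq, eval_ifLt, eval_add, eval_sub, eval_mul, eval_div, eval_mod,
    eval_load, eval_ofNat, eval_reg_two, eval_reg_three, hb, hr, OVInstance.blockLetter]
  by_cases h0 : r' % 2 = 0
  · rw [if_pos h0, if_pos h0]
  rw [if_neg h0, if_neg h0]
  by_cases h1 : r' = 2 * x.d + 1
  · rw [if_pos h1, if_pos h1]
  rw [if_neg h1, if_neg h1]
  -- The expression tests `b' + 1 < 2 * x.n` explicitly: beyond the first family `bit` is 0, whereas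
  -- the memory continues with the second family.
  refine if_congr Iff.rfl rfl ?_
  split_ifs with h2
  · have hk : r' / 2 < x.d := by omega
    have hi : b' + 1 - x.n < x.n := by omega
    have := OVInstance.index_lt hi hk
    rw [hmem _ (by rw [x.length_encode]; omega), x.getD_encode_A hi hk]
  · rw [OVInstance.bit_of_le _ _ (by omega)]

theorem eval_textLetterE (hmem : ∀ a < x.encode.length, mem a = x.encode.getD a 0)
    {j : Expr} {j' : ℕ} (hj : j.eval (regsOf L i x.n x.d) mem = j') :
    (textLetterE j).eval (regsOf L i x.n x.d) mem = x.textLetter j' := by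
  refine eval_blockLetterE x L i hmem ?_ ?_ (Nat.mod_lt _ (by omega))
  · simp only [eval_div, eval_add, eval_mul, eval_ofNat, eval_reg_three, hj]
  · simp only [eval_mod, eval_add, eval_mul, eval_ofNat, eval_reg_three, hj]

theorem eval_gapKindE (hmem : ∀ a < x.encode.length, mem a = x.encode.getD a 0)
    {j : Expr} {j' : ℕ} (hj : j.eval (regsOf L i x.n x.d) mem = j')
    (hlt : j' < x.patternLength) :
    (gapKindE j).eval (regsOf L i x.n x.d) mem = x.gapKind j' := by
  simp only [gapKindE, eval_ifEq, eval_add, eval_mul, eval_div, eval_mod, eval_load, eval_ofNat,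
    eval_reg_two, eval_reg_three, hj, OVInstance.gapKind]
  split_ifs with h
  · rfl
  · have hk : j' % (x.d + 1) < x.d := by
      have := Nat.mod_lt j' (show 0 < x.d + 1 by omega)
      omega
    have hi : j' / (x.d + 1) < x.n := Nat.div_lt_of_lt_mul (by
      rw [Nat.mul_comm]; exact hlt)
    have := OVInstance.index_lt hi hk
    rw [hmem _ (by rw [x.length_encode]; omega), x.getD_encode_B hi hk]

theorem eval_outCellE (hmem : ∀ a < x.encode.length, mem a = x.encode.getD a 0)
    (hi : i < x.outLength) :
    outCellE.eval (regsOf L i x.n x.d) mem = x.outCell i := by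
  simp only [outCellE, eval_ifLt, eval_add, eval_ofNat, eval_reg_one, eval_textLengthE,
    eval_patternLengthE, OVInstance.outCell]
  by_cases h1 : i < 3
  · rw [if_pos h1, if_pos h1]
    exact if_congr Iff.rfl rfl (if_congr Iff.rfl rfl rfl)
  rw [if_neg h1, if_neg h1]
  refine if_congr Iff.rfl (eval_textLetterE x L i hmem rfl) ?_
  refine ite_congr rfl (fun _ => rfl) fun h2 => ?_
  unfold OVInstance.outLength at hi
  have hk : (gapKindE ((reg 1 - (3 + textLengthE + patternLengthE)) / 17)).eval
      (regsOf L i x.n x.d) mem = _ :=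
    eval_gapKindE x L i hmem (j' := (i - (3 + x.textLength + x.patternLength)) / 17) rfl
      (by omega)
  simp only [gapCellE, eval_mod, eval_bin, eval_lit, eval_mul, eval_add, eval_ofNat, hk,
    eval_sub, eval_reg_one, eval_textLengthE, eval_patternLengthE, BinOp.eval]
  exact gapTable_spec _ (Nat.lt_succ_of_le (x.gapKind_le _)) _ (Nat.mod_lt _ (by norm_num))

end eval

/-- A bound for the constants in the program. -/
def constBound : ℕ := 2 ^ 102

theorem le_constBound {k : ℕ} (hk : k ≤ 100) : k ≤ constBound := hk.trans (by norm_num [constBound])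

/-- The table has 3 * 17 = 51 digits in base 4, that is 102 bits. -/
theorem gapTable_le : gapTable ≤ constBound := by norm_num [constBound, gapTable]

theorem one_le_constBound : 1 ≤ constBound := le_constBound (by norm_num)

theorem good_textLengthE : textLengthE.Good constBound := by
  unfold textLengthE
  repeat' first
    | apply Good.add | apply Good.sub | apply Good.mul | apply good_reg | apply good_ofNat
    | apply le_constBound
  all_goals norm_num

theorem good_patternLengthE : patternLengthE.Good constBound := by
  unfold patternLengthE
  repeat' first
    | apply Good.add | apply Good.mul | apply good_reg | apply good_ofNat | apply le_constBound
  all_goals norm_num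

theorem good_outLengthE : outLengthE.Good constBound := by
  unfold outLengthE
  repeat' first
    | exact good_textLengthE | exact good_patternLengthE
    | apply Good.add | apply Good.sub | apply Good.mul | apply good_ofNat | apply le_constBound
  all_goals norm_num

theorem good_textLetterE {j : Expr} (hj : j.Good constBound) : (textLetterE j).Good constBound := by
  unfold textLetterE blockLetterE
  repeat' first
    | exact hj | exact one_le_constBound | apply Good.ifLt | apply Good.ifEq | apply Good.load
    | apply Good.add | apply Good.sub | apply Good.mul | apply Good.div | apply Good.mod
    | apply good_reg | apply good_ofNat | apply le_constBound
  all_goals norm_num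

theorem good_gapKindE {j : Expr} (hj : j.Good constBound) : (gapKindE j).Good constBound := by
  unfold gapKindE
  repeat' first
    | exact hj | exact one_le_constBound | apply Good.ifEq | apply Good.load
    | apply Good.add | apply Good.mul | apply Good.div | apply Good.mod
    | apply good_reg | apply good_ofNat | apply le_constBound
  all_goals norm_num

theorem good_outCellE : outCellE.Good constBound := by
  unfold outCellE gapCellE
  repeat' first
    | exact good_textLengthE | exact good_patternLengthE | apply good_textLetterE
    | apply good_gapKindE | exact one_le_constBound | exact ⟨trivial, gapTable_le⟩
    | apply Good.ifLt | apply Good.shiftRight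
    | apply Good.add | apply Good.sub | apply Good.mul | apply Good.div | apply Good.mod
    | apply good_reg | apply good_ofNat | apply le_constBound
  all_goals norm_num

end RAM.Translation
end

noncomputable section

/-! ### The code of the translation -/

namespace RAM.Translation

open RAM.Expr

/-- Read `n` and `d`, and compute the length of the output. -/
def setup : List Instr :=
  setCode 2 (load 0) ++ (setCode 3 (load 1) ++ setCode 0 outLengthE)

/-- Write the cell `i` of the output, shifted by its length. -/
def writeBody : List Instr := storeCode (reg 0 + reg 1) outCellE ++ setCode 1 (reg 1 + 1)

/-- Move the cell `i` of the output to its place. -/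
def moveBody : List Instr :=
  storeCode (reg 1) (load (reg 0 + reg 1)) ++ (storeCode (reg 0 + reg 1) 0 ++ setCode 1 (reg 1 + 1))

/-- Clear the registers. -/
def cleanup : List Instr := setCode 1 0 ++ (setCode 2 0 ++ setCode 3 0)

def writeLoop : List Instr := loopCode setup.length writeBody

def moveLoop : List Instr :=
  loopCode (setup.length + writeLoop.length + (setCode 1 0).length) moveBody

/-- The program that translates instances of OV into instances of the matching problem. -/
def program : Program :=
  setup ++ (writeLoop ++ (setCode 1 0 ++ (moveLoop ++ cleanup)))

/-- A bound for the numbers between two statements. -/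
def bound (x : OVInstance) : ℕ := (x.encode.length + 2) ^ 102

/-! ### Contents of the memory during the two loops -/

section memory

variable (x : OVInstance)

/-- The memory after `k` iterations of the first loop. -/
def writeMem (k a : ℕ) : ℕ :=
  if x.outLength ≤ a ∧ a < x.outLength + k then x.outCell (a - x.outLength)
  else x.encode.getD a 0

/-- The memory after `k` iterations of the second loop. -/
def moveMem (k a : ℕ) : ℕ :=
  if a < k then x.outCell a
  else if x.outLength ≤ a ∧ a < x.outLength + k then 0
  else writeMem x x.outLength a

/-- The output is first written from cell `outLength` on; this inequality ensures that the input
survives until it has been read completely. -/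
theorem length_encode_le : x.encode.length ≤ x.outLength := by
  have hn := x.n_pos
  have h1 : 1 * (2 * x.d + 2) ≤ (3 * x.n - 2) * (2 * x.d + 2) := Nat.mul_le_mul_right _ (by omega)
  have h2 : x.n * x.d ≤ (3 * x.n - 2) * x.d := Nat.mul_le_mul_right _ (by omega)
  have h3 : (3 * x.n - 2) * (2 * x.d + 2) = 2 * ((3 * x.n - 2) * x.d) + 2 * (3 * x.n - 2) := by ring
  rw [x.length_encode]
  unfold OVInstance.outLength OVInstance.textLength
  omega

theorem outLength_le : x.outLength ≤ 27 * (x.n * (x.d + 1)) := by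
  have h2 : (3 * x.n - 2) * (2 * x.d + 2) ≤ (3 * x.n) * (2 * x.d + 2) :=
    Nat.mul_le_mul_right _ (by omega)
  have h3 : 3 * x.n * (2 * x.d + 2) = 6 * (x.n * (x.d + 1)) := by ring
  have h4 : 1 ≤ x.n * (x.d + 1) := x.patternLength_pos
  unfold OVInstance.outLength OVInstance.textLength OVInstance.patternLength
  omega

theorem outLength_add_two_le : x.outLength + 2 ≤ (x.encode.length + 2) ^ 6 := by
  have h1 := outLength_le x
  have hd := x.d_pos
  have h2 : x.n * (x.d + 1) ≤ 2 * (x.n * x.d) := by nlinarith [x.n_pos]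
  have h3 := x.length_encode
  have h4 : 4 ≤ x.encode.length + 2 := by omega
  calc x.outLength + 2 ≤ 27 * (x.encode.length + 2) := by omega
    _ ≤ 4 ^ 5 * (x.encode.length + 2) := Nat.mul_le_mul_right _ (by norm_num)
    _ ≤ (x.encode.length + 2) ^ 5 * (x.encode.length + 2) :=
      Nat.mul_le_mul_right _ (Nat.pow_le_pow_left h4 5)
    _ = _ := (pow_succ _ _).symm

theorem outLength_le_bound : x.outLength ≤ bound x :=
  (Nat.le_add_right _ 2).trans ((outLength_add_two_le x).trans
    (Nat.pow_le_pow_right (by omega) (by norm_num)))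

/-- The base of `bound` is at least 2, so its exponent 102 makes room for `gapTable`. -/
theorem constBound_le_bound : constBound ≤ bound x := Nat.pow_le_pow_left (by omega) 102

theorem two_le_bound : 2 ≤ bound x :=
  (Nat.le_add_left 2 _).trans (Nat.le_self_pow (by norm_num) _)

theorem getD_encode_le_bound (a : ℕ) : x.encode.getD a 0 ≤ bound x :=
  (x.getD_encode_le a).trans ((length_encode_le x).trans (outLength_le_bound x))

theorem n_le_bound : x.n ≤ bound x := getD_encode_le_bound x 0

theorem d_le_bound : x.d ≤ bound x := getD_encode_le_bound x 1

theorem writeMem_le (k a : ℕ) : writeMem x k a ≤ bound x := by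
  unfold writeMem
  split_ifs
  · exact (x.outCell_le _).trans (outLength_le_bound x)
  · exact getD_encode_le_bound x a

theorem moveMem_le (k a : ℕ) : moveMem x k a ≤ bound x := by
  unfold moveMem
  split_ifs
  · exact (x.outCell_le _).trans (outLength_le_bound x)
  · exact Nat.zero_le _
  · exact writeMem_le x _ a

theorem writeMem_zero : writeMem x 0 = (init x.encode).mem := by
  funext a
  exact if_neg (by omega)

theorem writeMem_of_lt (k : ℕ) {a : ℕ} (ha : a < x.encode.length) :
    writeMem x k a = x.encode.getD a 0 := by
  have := length_encode_le x
  exact if_neg (by omega)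

theorem update_writeMem (k : ℕ) :
    Function.update (writeMem x k) (x.outLength + k) (x.outCell k) = writeMem x (k + 1) := by
  funext a
  by_cases h : a = x.outLength + k
  · subst h
    rw [Function.update_self, writeMem, if_pos (by omega), Nat.add_sub_cancel_left]
  · rw [Function.update_of_ne h, writeMem, writeMem]
    exact if_congr (by omega) rfl rfl

theorem moveMem_zero : moveMem x 0 = writeMem x x.outLength := by
  funext a
  rw [moveMem, if_neg (by omega), if_neg (by omega)]

theorem moveMem_source {k : ℕ} (hk : k < x.outLength) :
    moveMem x k (x.outLength + k) = x.outCell k := by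
  rw [moveMem, if_neg (by omega), if_neg (by omega), writeMem, if_pos (by omega),
    Nat.add_sub_cancel_left]

theorem update_moveMem {k : ℕ} (hk : k < x.outLength) :
    Function.update (Function.update (moveMem x k) k (x.outCell k)) (x.outLength + k) 0 =
      moveMem x (k + 1) := by
  funext a
  by_cases h : a = x.outLength + k
  · subst h
    rw [Function.update_self, moveMem, if_neg (by omega), if_pos (by omega)]
  · rw [Function.update_of_ne h]
    by_cases h' : a = k
    · subst h'
      rw [Function.update_self, moveMem, if_pos (by omega)]
    · rw [Function.update_of_ne h', moveMem, moveMem]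
      exact if_congr (by omega) rfl (if_congr (by omega) rfl rfl)

/-- The moved output covers the input, the source cells have been cleared, and nothing was ever
written beyond them; so no trace of the translation is left. -/
theorem moveMem_outLength : moveMem x x.outLength = (init x.toMatch.encode).mem := by
  funext a
  change _ = x.toMatch.encode.getD a 0
  rw [moveMem]
  split_ifs with h1 h2
  · exact (x.getD_encode_toMatch h1).symm
  · rw [List.getD_eq_default]
    rw [x.length_encode_toMatch]; omega
  · have := length_encode_le x
    rw [writeMem, if_neg h2, List.getD_eq_default _ _ (by omega), List.getD_eq_default]
    rw [x.length_encode_toMatch]; omega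

end memory

theorem init_regs (l : List ℕ) : (init l).regs = regsOf l.length 0 0 0 := by
  funext r
  simp only [init, regsOf]
  split_ifs <;> rfl

/-- The number of steps of the translation. -/
def time (x : OVInstance) : ℕ :=
  setup.length + ((x.outLength * (writeBody.length + 4) + 2) + ((setCode 1 0).length +
    ((x.outLength * (moveBody.length + 4) + 2) + cleanup.length)))

/-! ### Correctness and running time of the translation -/

section steps

variable {P : Program} {m : ℕ} (x : OVInstance)

/-- An assignment executed in a state in which the relevant numbers are bounded. -/
theorem steps_set {pc r : ℕ} {e : Expr} {a b c d v : ℕ} {mem regs' : ℕ → ℕ}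
    (hP : CodeAt P pc (setCode r e)) (he : e.Good constBound) (hm : (setCode r e).length ≤ m)
    (hr : r < 4) (ha : a ≤ bound x) (hb : b ≤ bound x) (hc : c ≤ bound x) (hd : d ≤ bound x)
    (hmem : ∀ s, mem s ≤ bound x) (hv : e.eval (regsOf a b c d) mem = v)
    (hregs : Function.update (regsOf a b c d) r v = regs') :
    Steps P (bound x ^ 3 ^ m) (setCode r e).length ⟨pc, regsOf a b c d, mem⟩
      ⟨pc + (setCode r e).length, regs', mem⟩ := by
  subst hv hregs
  exact steps_setCode hP hr he.1 he.2 (constBound_le_bound x) (two_le_bound x) hm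
    (fun s hs => regsOf_of_le a b c d hs) (regsOf_le ha hb hc hd) hmem

/-- A store executed in a state in which the relevant numbers are bounded. -/
theorem steps_store {pc : ℕ} {e f : Expr} {a b c d u v : ℕ} {mem mem' : ℕ → ℕ}
    (hP : CodeAt P pc (storeCode f e)) (hf : f.Good constBound) (he : e.Good constBound)
    (hm : (storeCode f e).length ≤ m)
    (ha : a ≤ bound x) (hb : b ≤ bound x) (hc : c ≤ bound x) (hd : d ≤ bound x)
    (hmem : ∀ s, mem s ≤ bound x) (hu : f.eval (regsOf a b c d) mem = u)
    (hv : e.eval (regsOf a b c d) mem = v) (hmem' : Function.update mem u v = mem') :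
    Steps P (bound x ^ 3 ^ m) (storeCode f e).length ⟨pc, regsOf a b c d, mem⟩
      ⟨pc + (storeCode f e).length, regsOf a b c d, mem'⟩ := by
  subst hu hv hmem'
  exact steps_storeCode hP hf.1 he.1 hf.2 he.2 (constBound_le_bound x) (two_le_bound x) hm
    (fun s hs => regsOf_of_le a b c d hs) (regsOf_le ha hb hc hd) hmem

theorem good_zero : (0 : Expr).Good constBound := good_ofNat (le_constBound (by norm_num))

theorem good_one : (1 : Expr).Good constBound := good_ofNat (le_constBound (by norm_num))

theorem good_sum : (reg 0 + reg 1).Good constBound :=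
  (good_reg (by norm_num)).add (good_reg (by norm_num))

theorem good_succ : (reg 1 + 1).Good constBound := (good_reg (by norm_num)).add good_one

theorem steps_setup (hP : CodeAt P 0 setup) (hm : setup.length ≤ m) :
    Steps P (bound x ^ 3 ^ m) setup.length (init x.encode)
      ⟨setup.length, regsOf x.outLength 0 x.n x.d, writeMem x 0⟩ := by
  have hl : x.encode.length ≤ bound x := (length_encode_le x).trans (outLength_le_bound x)
  have hinit : init x.encode = ⟨0, regsOf x.encode.length 0 0 0, writeMem x 0⟩ := by
    rw [writeMem_zero, ← init_regs]
    rfl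
  have hlen : setup.length = (setCode 2 (load 0)).length + ((setCode 3 (load 1)).length +
      (setCode 0 outLengthE).length) := by
    simp only [setup, List.length_append]
  have h0 := Nat.zero_le (bound x)
  have s1 := steps_set x (m := m) (a := x.encode.length) (b := 0) (c := 0) (d := 0)
    hP.left good_zero.load (by omega) (by norm_num) hl h0 h0 h0
    (writeMem_le x 0) (v := x.n) (by rw [writeMem_zero]; rfl) (update_regsOf_two _ _ _ _ _)
  have s2 := steps_set x (m := m) (a := x.encode.length) (b := 0) (c := x.n) (d := 0)
    hP.right.left good_one.load (by omega) (by norm_num) hl h0 (n_le_bound x) h0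
    (writeMem_le x 0) (v := x.d) (by rw [writeMem_zero]; rfl) (update_regsOf_three _ _ _ _ _)
  have s3 := steps_set x (m := m) (a := x.encode.length) (b := 0) (c := x.n) (d := x.d)
    hP.right.right good_outLengthE (by omega) (by norm_num) hl h0 (n_le_bound x) (d_le_bound x)
    (writeMem_le x 0) (eval_outLengthE x _ _ _) (update_regsOf_zero _ _ _ _ _)
  rw [hinit, hlen]
  have := s1.trans (s2.trans s3)
  simpa only [Nat.zero_add, Nat.add_assoc] using this

theorem steps_writeBody {o k : ℕ} (hP : CodeAt P o writeBody) (hm : writeBody.length ≤ m)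
    (hk : k < x.outLength) :
    Steps P (bound x ^ 3 ^ m) writeBody.length
      ⟨o, regsOf x.outLength k x.n x.d, writeMem x k⟩
      ⟨o + writeBody.length, regsOf x.outLength (k + 1) x.n x.d, writeMem x (k + 1)⟩ := by
  have hlen : writeBody.length = (storeCode (reg 0 + reg 1) outCellE).length +
      (setCode 1 (reg 1 + 1)).length := by
    simp only [writeBody, List.length_append]
  have hL := outLength_le_bound x
  have s1 := steps_store x (m := m) hP.left good_sum good_outCellE (by omega) hL (hk.le.trans hL)
    (n_le_bound x) (d_le_bound x) (writeMem_le x k) rfl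
    (eval_outCellE x _ k (fun a ha => writeMem_of_lt x k ha) hk) (update_writeMem x k)
  have s2 := steps_set x (m := m) hP.right good_succ (by omega) (by norm_num) hL (hk.le.trans hL)
    (n_le_bound x) (d_le_bound x) (writeMem_le x (k + 1)) (v := k + 1) rfl
    (update_regsOf_one _ _ _ _ _)
  rw [hlen]
  have := s1.trans s2
  rwa [Nat.add_assoc] at this

theorem steps_moveBody {o k : ℕ} (hP : CodeAt P o moveBody) (hm : moveBody.length ≤ m)
    (hk : k < x.outLength) :
    Steps P (bound x ^ 3 ^ m) moveBody.length
      ⟨o, regsOf x.outLength k x.n x.d, moveMem x k⟩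
      ⟨o + moveBody.length, regsOf x.outLength (k + 1) x.n x.d, moveMem x (k + 1)⟩ := by
  have hlen : moveBody.length = (storeCode (reg 1) (load (reg 0 + reg 1))).length +
      ((storeCode (reg 0 + reg 1) 0).length + (setCode 1 (reg 1 + 1)).length) := by
    simp only [moveBody, List.length_append]
  have hL := outLength_le_bound x
  have hmem : ∀ s, Function.update (moveMem x k) k (x.outCell k) s ≤ bound x := by
    intro s
    by_cases hs : s = k
    · subst hs
      rw [Function.update_self]
      exact (x.outCell_le _).trans hL
    · rw [Function.update_of_ne hs]
      exact moveMem_le x k s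
  have s1 := steps_store x (m := m) hP.left (good_reg (by norm_num)) good_sum.load (by omega) hL
    (hk.le.trans hL) (n_le_bound x) (d_le_bound x) (moveMem_le x k) rfl
    (v := x.outCell k) (moveMem_source x hk) rfl
  have s2 := steps_store x (m := m) hP.right.left good_sum good_zero (by omega) hL
    (hk.le.trans hL) (n_le_bound x) (d_le_bound x) hmem rfl rfl (update_moveMem x hk)
  have s3 := steps_set x (m := m) hP.right.right good_succ (by omega) (by norm_num) hL
    (hk.le.trans hL) (n_le_bound x) (d_le_bound x) (moveMem_le x (k + 1)) (v := k + 1) rfl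
    (update_regsOf_one _ _ _ _ _)
  rw [hlen]
  have := s1.trans (s2.trans s3)
  simpa only [Nat.add_assoc] using this

theorem steps_cleanup {o : ℕ} (hP : CodeAt P o cleanup) (hm : cleanup.length ≤ m) :
    Steps P (bound x ^ 3 ^ m) cleanup.length
      ⟨o, regsOf x.outLength x.outLength x.n x.d, moveMem x x.outLength⟩
      ⟨o + cleanup.length, (init x.toMatch.encode).regs, (init x.toMatch.encode).mem⟩ := by
  have hlen : cleanup.length = (setCode 1 0).length + ((setCode 2 0).length +
      (setCode 3 0).length) := by
    simp only [cleanup, List.length_append]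
  have hL := outLength_le_bound x
  have h0 := Nat.zero_le (bound x)
  have hmem := moveMem_le x x.outLength
  have s1 := steps_set x (m := m) hP.left good_zero (by omega) (by norm_num) hL hL (n_le_bound x)
    (d_le_bound x) hmem (v := 0) rfl (update_regsOf_one _ _ _ _ _)
  have s2 := steps_set x (m := m) hP.right.left good_zero (by omega) (by norm_num) hL h0
    (n_le_bound x) (d_le_bound x) hmem (v := 0) rfl (update_regsOf_two _ _ _ _ _)
  have s3 := steps_set x (m := m) hP.right.right good_zero (by omega) (by norm_num) hL h0
    h0 (d_le_bound x) hmem (v := 0) rfl (update_regsOf_three _ _ _ _ _)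
  rw [hlen, ← moveMem_outLength, init_regs, x.length_encode_toMatch]
  have := s1.trans (s2.trans s3)
  simpa only [Nat.add_assoc] using this

theorem codeAt_loopBody {o : ℕ} {body : List Instr} (hP : CodeAt P o (loopCode o body)) :
    CodeAt P (o + 3) body :=
  CodeAt.right hP.left

theorem regsOf_le_bound {k : ℕ} (hk : k ≤ x.outLength) {B : ℕ} (hB : bound x ≤ B) (s : ℕ) :
    regsOf x.outLength k x.n x.d s ≤ B :=
  (regsOf_le (outLength_le_bound x) (hk.trans (outLength_le_bound x)) (n_le_bound x)
    (d_le_bound x) s).trans hB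

/-- Each statement is no longer than the whole program, so the single exponent `3 ^ program.length`
serves all of them. -/
theorem steps_program (hP : CodeAt P 0 program) :
    Steps P (bound x ^ 3 ^ program.length) (time x) (init x.encode)
      ⟨program.length, (init x.toMatch.encode).regs, (init x.toMatch.encode).mem⟩ := by
  have hlen : program.length = setup.length + (writeLoop.length + ((setCode 1 0).length +
      (moveLoop.length + cleanup.length))) := by
    simp only [program, List.length_append]
  have hw : writeLoop.length = writeBody.length + 4 := length_loopCode _ _
  have hv : moveLoop.length = moveBody.length + 4 := length_loopCode _ _
  generalize hm : program.length = m at *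
  have hB : bound x ≤ bound x ^ 3 ^ m := Nat.le_self_pow (by positivity) _
  have hL := outLength_le_bound x
  have c1 := hP.left
  have c2 := hP.right.left
  have c3 := hP.right.right.left
  have c4 := hP.right.right.right.left
  have c5 := hP.right.right.right.right
  simp only [Nat.zero_add] at c2 c3 c4 c5
  have s1 := steps_setup x (m := m) c1 (by omega)
  have s2 := steps_loopCode (N := x.outLength) (t := writeBody.length)
    (regs := fun k => regsOf x.outLength k x.n x.d) (mem := writeMem x) c2
    (fun _ _ => rfl) (fun _ _ => rfl) (fun _ _ => rfl) (fun k hk => regsOf_le_bound x hk hB)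
    (fun k _ s => (writeMem_le x k s).trans hB)
    (fun k hk => steps_writeBody x (codeAt_loopBody c2) (by omega) hk)
  have s3 := steps_set x (m := m) c3 good_zero (by omega) (by norm_num) hL hL (n_le_bound x)
    (d_le_bound x) (writeMem_le x x.outLength) (v := 0) rfl (update_regsOf_one _ _ _ _ _)
  have s4 := steps_loopCode (N := x.outLength) (t := moveBody.length)
    (regs := fun k => regsOf x.outLength k x.n x.d) (mem := moveMem x) c4
    (fun _ _ => rfl) (fun _ _ => rfl) (fun _ _ => rfl) (fun k hk => regsOf_le_bound x hk hB)
    (fun k _ s => (moveMem_le x k s).trans hB)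
    (fun k hk => steps_moveBody x (codeAt_loopBody c4) (by omega) hk)
  have s5 := steps_cleanup x (m := m) c5 (by omega)
  rw [← hw] at s2
  rw [← hv] at s4
  rw [moveMem_zero] at s4
  have := s1.trans (s2.trans (s3.trans (s4.trans s5)))
  rw [time, ← hw, ← hv]
  rw [hlen] at this ⊢
  simpa only [Nat.add_assoc] using this

end steps

end RAM.Translation
end

/-! ### The lower bound -/

theorem RAM.Decides.mono {P : RAM.Program} {ι : Type} {enc : ι → List ℕ} {yes : ι → Prop}
    {S : Set ι} {T T' : ι → ℝ} (h : RAM.Decides P enc yes S T) (hT : ∀ x ∈ S, T x ≤ T' x) :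
    RAM.Decides P enc yes S T' := by
  obtain ⟨c, hc⟩ := h
  refine ⟨c, fun x hx => ?_⟩
  obtain ⟨t, ht, h⟩ := hc x hx
  exact ⟨t, ht.trans (hT x hx), h⟩

theorem RAM.Translation.decides {P : RAM.Program} {S : Set MatchInstance} {T : MatchInstance → ℝ}
    (hS : ∀ x : OVInstance, x.toMatch ∈ S)
    (hP : RAM.Decides P MatchInstance.encode MatchInstance.Matches S T) :
    RAM.Decides (program ++ P.map (RAM.Instr.shift program.length)) OVInstance.encode
      OVInstance.HasOrthogonalPair Set.univ (fun x => time x + T x.toMatch) := by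
  refine RAM.Decides.of_translation OVInstance.toMatch time (102 * 3 ^ program.length) 6
    (fun x _ => hS x) (fun x _ => x.matches_toMatch_iff)
    (fun x _ => x.length_encode_toMatch ▸ outLength_add_two_le x) (fun x _ => ?_) hP
  rw [pow_mul]
  exact steps_program x (RAM.codeAt_zero _ _)

theorem RAM.Translation.time_le (x : OVInstance) :
    time x ≤ (setup.length + writeBody.length + (setCode 1 0).length + moveBody.length +
      cleanup.length + 12) * x.outLength := by
  have h : 1 ≤ x.outLength := by unfold OVInstance.outLength; omega
  unfold time
  generalize setup.length = a
  generalize writeBody.length = b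
  generalize (setCode 1 0).length = c
  generalize moveBody.length = d
  generalize cleanup.length = e
  nlinarith [Nat.mul_le_mul_left (a + c + e + 4) h]

/-- A real power of a quantity that agrees with `n` up to the factor `D`. -/
theorem rpow_le_of_between {n y D : ℝ} (hn : 0 < n) (h1 : n ≤ y) (h2 : y ≤ n * D) (r : ℝ) {k : ℕ}
    (hk : |r| ≤ k) : y ^ r ≤ n ^ r * D ^ k := by
  have hD : 1 ≤ D := by
    by_contra h
    nlinarith
  -- The ratio `y / n` lies between 1 and `D`, so its power with exponent `r` is at most `D ^ k`.
  -- The lower bound is what makes negative `r` admissible.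
  have hz1 : 1 ≤ y / n := (one_le_div hn).2 h1
  have hz2 : y / n ≤ D := (div_le_iff₀ hn).2 (by linarith)
  have hy : y = n * (y / n) := by field_simp
  rw [hy, Real.mul_rpow hn.le (by linarith)]
  refine mul_le_mul_of_nonneg_left ?_ (Real.rpow_nonneg hn.le r)
  calc (y / n) ^ r ≤ (y / n) ^ (k : ℝ) :=
        Real.rpow_le_rpow_of_exponent_le hz1 ((le_abs_self r).trans hk)
    _ = (y / n) ^ k := Real.rpow_natCast _ _
    _ ≤ D ^ k := pow_le_pow_left₀ (by linarith) hz2 k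

theorem not_matchSolvable (hOVH : OVH) {S : Set MatchInstance}
    (hS : ∀ x : OVInstance, x.toMatch ∈ S) {h g ε : ℝ} (hε : 0 < ε) (hhg : h + g = 2 - ε) :
    ¬ MatchSolvable S h g := by
  rintro ⟨P, C, hP⟩
  obtain ⟨k, hk⟩ := exists_nat_ge |h|
  obtain ⟨l, hl⟩ := exists_nat_ge |g|
  obtain ⟨c, hc⟩ : ∃ c : ℕ, ∀ x, RAM.Translation.time x ≤ c * x.outLength :=
    ⟨_, RAM.Translation.time_le⟩
  -- Capping `ε` at 1 keeps `n` itself below n^(2 - ε), which absorbs the translation and the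
  -- granted linear time. The polynomial has one factor for each unit of `k` and `l`, and one more
  -- for the linear terms.
  refine hOVH (min ε 1) (lt_min hε one_pos) ⟨_, c + 2 * |C|,
    (27 * (Polynomial.X + 1)) ^ (k + l + 1), (RAM.Translation.decides hS hP).mono fun x _ => ?_⟩
  have hn : (1 : ℝ) ≤ x.n := by exact_mod_cast x.n_pos
  have hd := x.d_pos
  have hq : ((((27 * (Polynomial.X + 1)) ^ (k + l + 1) : Polynomial ℕ).eval x.d : ℕ) : ℝ) =
      (27 * ((x.d : ℝ) + 1)) ^ (k + l + 1) := by
    simp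
  have hDn : ∀ m : ℕ, m ≤ 27 * (x.n * (x.d + 1)) → (m : ℝ) ≤ x.n * (27 * (x.d + 1)) := by
    intro m hm
    have : (m : ℝ) ≤ 27 * (x.n * (x.d + 1)) := by exact_mod_cast hm
    linarith
  have hL := hDn _ (RAM.Translation.outLength_le x)
  -- As `d` is positive, the number of gaps is at least `n`; hence `states` is at least `n`, as
  -- needed for `rpow_le_of_between`.
  have hP1 : x.n + 1 ≤ x.patternLength := by
    have : x.n * 2 ≤ x.n * (x.d + 1) := Nat.mul_le_mul_left _ (by omega)
    have := x.n_pos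
    unfold OVInstance.patternLength
    omega
  have hout := RAM.Translation.outLength_le x
  have hPT := x.patternLength_le
  unfold OVInstance.outLength at hout
  have hw : (x.toMatch.w.length : ℝ) ^ h ≤ (x.n : ℝ) ^ h * (27 * ((x.d : ℝ) + 1)) ^ k := by
    rw [show x.toMatch.w.length = x.textLength from x.length_text]
    exact rpow_le_of_between (by linarith) (by exact_mod_cast (by omega : x.n ≤ x.textLength))
      (hDn _ (by omega)) h hk
  have hs : (x.toMatch.states : ℝ) ^ g ≤ (x.n : ℝ) ^ g * (27 * ((x.d : ℝ) + 1)) ^ l := by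
    rw [x.states_toMatch]
    exact rpow_le_of_between (by linarith)
      (by exact_mod_cast (by omega : x.n ≤ 3 * (x.patternLength - 1))) (hDn _ (by omega)) g hl
  rw [hq, x.length_encode_toMatch]
  have hD : (1 : ℝ) ≤ 27 * ((x.d : ℝ) + 1) := by
    have : (0 : ℝ) ≤ x.d := Nat.cast_nonneg _
    linarith
  set D : ℝ := 27 * ((x.d : ℝ) + 1)
  set E : ℝ := (x.n : ℝ) ^ (2 - min ε 1)
  have hE : (x.n : ℝ) ≤ E := by
    conv_lhs => rw [← Real.rpow_one (x.n : ℝ)]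
    exact Real.rpow_le_rpow_of_exponent_le hn (by linarith [min_le_right ε 1])
  have hE' : (x.n : ℝ) ^ (h + g) ≤ E :=
    Real.rpow_le_rpow_of_exponent_le hn (by linarith [min_le_left ε 1])
  have hE0 : 0 ≤ E := by linarith
  have hDk : D ^ (k + l) ≤ D ^ (k + l + 1) := pow_le_pow_right₀ hD (by omega)
  have hD1 : D ≤ D ^ (k + l + 1) := le_self_pow₀ hD (by omega)
  have hLE : (x.outLength : ℝ) ≤ E * D ^ (k + l + 1) :=
    hL.trans (mul_le_mul hE hD1 (by linarith) hE0)
  have hprod : (x.toMatch.w.length : ℝ) ^ h * (x.toMatch.states : ℝ) ^ g ≤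
      E * D ^ (k + l + 1) := by
    calc _ ≤ ((x.n : ℝ) ^ h * D ^ k) * ((x.n : ℝ) ^ g * D ^ l) :=
          mul_le_mul hw hs (Real.rpow_nonneg (Nat.cast_nonneg _) _) (by positivity)
      _ = (x.n : ℝ) ^ (h + g) * D ^ (k + l) := by
          rw [Real.rpow_add (by linarith), pow_add]; ring
      _ ≤ _ := mul_le_mul hE' hDk (by positivity) hE0
  have hprod0 : 0 ≤ (x.toMatch.w.length : ℝ) ^ h * (x.toMatch.states : ℝ) ^ g := by positivity
  have htime : (RAM.Translation.time x : ℝ) ≤ c * (E * D ^ (k + l + 1)) :=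
    le_trans (by exact_mod_cast hc x) (mul_le_mul_of_nonneg_left hLE (Nat.cast_nonneg c))
  have hrest : C * ((x.toMatch.w.length : ℝ) ^ h * (x.toMatch.states : ℝ) ^ g + x.outLength) ≤
      |C| * (E * D ^ (k + l + 1) + E * D ^ (k + l + 1)) :=
    mul_le_mul (le_abs_self C) (add_le_add hprod hLE) (by positivity) (abs_nonneg C)
  calc _ ≤ c * (E * D ^ (k + l + 1)) + |C| * (E * D ^ (k + l + 1) + E * D ^ (k + l + 1)) :=
        add_le_add htime hrest
    _ = _ := by ring

theorem mainTheorem8 (hOVH : OVH) :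
    (∀ h g ε : ℝ, 0 < ε → h + g = 2 - ε → ¬ MatchSolvable Set.univ h g) ∧
    ∃ K : ℕ, ∀ h g ε : ℝ, 0 < ε → h + g = 2 - ε →
      ¬ MatchSolvable {x | x.σ = 4 ∧ ∀ j, (x.gc j).numStates ≤ K} h g := by
  -- Every automaton of the reduction has three states.
  refine ⟨fun h g ε hε hhg => ?_, 3, fun h g ε hε hhg => ?_⟩
  · exact not_matchSolvable hOVH (fun _ => Set.mem_univ _) hε hhg
  · refine not_matchSolvable hOVH (fun x => ?_) hε hhg
    exact ⟨rfl, fun _ => le_rfl⟩
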